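/- **Definitions.** Let $\Sigma=\{a,\vartriangleleft,\vartriangleright,\#\}$. An encoding of a finite set $S\subset\mathbb N$ (where $0\in\mathbb N$) is any word $\vartriangleleft a^{x_1}\vartriangleright\,\vartriangleleft a^{x_2}\vartriangleright\cdots\vartriangleleft a^{x_t}\vartriangleright\in\Sigma^*$ with $t\ge 0$ and $\{x_1,\dots,x_t\}=S$; the elements may be listed in any order and with repetitions. For a family $\mathcal U$ of finite subsets of $\mathbb N$, let $\langle\mathcal U\rangle\subseteq\Sigma^*$ be the language of all encodings of all sets $S\in\mathcal U$. For a language $F\subseteq\Sigma^*$, let $\mathrm{NRR}(F)$ be the language of all descriptions of nondeterministic finite automata $\mathcal A$ over $\Sigma$ (without $\varepsilon$-transitions) such that $F\cap L(\mathcal A)\neq\varnothing$; an automaton is described by its initial state, the list of its accepting states and the list of its transitions, where the states are natural numbers written in unary. For languages $A,B$ over finite alphabets, $A\le_m^{P}B$ means that there is a function $f$ computable in polynomial time such that $x\in A\iff f(x)\in B$ for all $x$. The class $\mathrm{FNP}$ consists of the functions on words that are computable in polynomial time with an oracle for a language from $\mathrm{NP}$ (each oracle query takes one step). $A\le_{dtt}^{\mathrm{FNP}}B$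 means that there is a function in $\mathrm{FNP}$ that maps every word $x$ to a finite list of words $q_1,\dots,q_s$ such that $x\in A\iff(q_1\in B)\lor\dots\lor(q_s\in B)$ (for $s=0$ the disjunction is false). **Theorem.** For every nonempty language $X\subseteq\{0,1\}^*$ there exists a family $\mathcal U_X$ of finite subsets of $\mathbb N$ such that $$X\;\le_m^{P}\;\mathrm{NRR}(\langle\mathcal U_X\rangle)\;\le_{dtt}^{\mathrm{FNP}}\;X.$$ -/

import Mathlib

open Computability

namespace RegReal

/-! ### Polynomial time, with and without an oracle

Polynomial time computability is Mathlib's `Turing.TM2ComputableInPolyTime` (multi-stack Turing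
machines). Mathlib has no oracle machines; they are the same machines with query labels. -/

/-- The word function `f` is computable in polynomial time. -/
def PolyTime {α β : Type} (f : List α → List β) : Prop :=
  Nonempty (Turing.TM2ComputableInPolyTime (encodingList α).encode (encodingList β).encode f)

/-- A multi-stack Turing machine with input alphabet `Γ₀` and output alphabet `Γ₁`, a binary query
stack, and query labels. At a label `l` with `query l = some (yes, no)` the machine asks the oracle
about the word on the query stack; at all other labels it runs its program. -/
structure OracleTM (Γ₀ Γ₁ : Type) extends Turing.TM2ComputableAux Γ₀ Γ₁ where
  /-- the query stack -/
  queryStack : tm.K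
  /-- the query stack contains bits -/
  queryAlphabet : tm.Γ queryStack ≃ Bool
  /-- the query labels, with the two labels at which the machine may continue -/
  query : tm.Λ → Option (tm.Λ × tm.Λ)

/-- One step of an oracle machine. A query takes one step: the word on the query stack (top symbol
first) is erased and the machine jumps to `yes` or `no` according to whether this word belongs
to `O`. -/
noncomputable def OracleTM.step {Γ₀ Γ₁ : Type} (M : OracleTM Γ₀ Γ₁) (O : Language Bool) :
    M.tm.Cfg → Option M.tm.Cfg
  | ⟨none, _, _⟩ => none
  | ⟨some l, v, S⟩ =>
    match M.query l with
    | none => some (Turing.TM2.stepAux (M.tm.m l) v S)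
    | some (yes, no) =>
      haveI := Classical.dec ((S M.queryStack).map M.queryAlphabet ∈ O)
      some ⟨some (if (S M.queryStack).map M.queryAlphabet ∈ O then yes else no), v,
        Function.update S M.queryStack []⟩

/-- The word function `f` is computable in polynomial time by a machine with oracle `O`. -/
def PolyTimeWithOracle {α β : Type} (O : Language Bool) (f : List α → List β) : Prop :=
  ∃ (M : OracleTM α β) (time : Polynomial ℕ), ∀ x : List α,
    Nonempty (StateTransition.EvalsToInTime (M.step O)
      (Turing.initList M.tm (x.map M.inputAlphabet.symm))
      (some (Turing.haltList M.tm ((f x).map M.outputAlphabet.symm)))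
      (time.eval x.length))

/-- The class NP: there are certificates of polynomial length that are verified in polynomial
time. -/
def InNP (L : Language Bool) : Prop :=
  ∃ (V : List Bool × List Bool → Bool) (p : Polynomial ℕ),
    Nonempty (Turing.TM2ComputableInPolyTime
      (encodingProd (encodingList Bool) (encodingList Bool)).encode encodingBoolBool.encode V) ∧
    ∀ x, x ∈ L ↔ ∃ y : List Bool, y.length ≤ p.eval x.length ∧ V (x, y) = true

/-- The class FNP: functions computable in polynomial time with an oracle for a language
from NP. -/
def InFNP {α β : Type} (f : List α → List β) : Prop :=
  ∃ O : Language Bool, InNP O ∧ PolyTimeWithOracle O f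

/-! ### Reductions -/

/-- Polynomial time many-one reducibility. -/
def ManyOneP {α β : Type} (A : Language α) (B : Language β) : Prop :=
  ∃ f : List α → List β, PolyTime f ∧ ∀ x, x ∈ A ↔ f x ∈ B

/-- A finite list of words as a single word: every word is followed by the delimiter `none`. -/
def encodeQueries {β : Type} (qs : List (List β)) : List (Option β) :=
  qs.flatMap fun q => q.map some ++ [none]

/-- Disjunctive truth table reducibility by functions from FNP: a function from FNP produces a list
of queries, and the answer is the disjunction of the answers to these queries. -/
def DttFNP {α β : Type} (A : Language α) (B : Language β) : Prop :=
  ∃ g : List α → List (List β), InFNP (fun x => encodeQueries (g x)) ∧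
    ∀ x, x ∈ A ↔ ∃ q ∈ g x, q ∈ B

/-! ### Encodings of finite unary relations -/

/-- The alphabet `{a, ⊲, ⊳, #}`. -/
inductive Letter
  | a
  | lt
  | rt
  | hash
  deriving DecidableEq

/-- The block `⊲ aˣ ⊳`. -/
def block (x : ℕ) : List Letter :=
  Letter.lt :: List.replicate x Letter.a ++ [Letter.rt]

/-- `w` is an encoding of the finite set `S`: a concatenation of blocks of elements of `S`, in any
order and with any repetitions, in which every element of `S` occurs. -/
def IsEncoding (S : Finset ℕ) (w : List Letter) : Prop :=
  ∃ xs : List ℕ, xs.toFinset = S ∧ w = xs.flatMap block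

/-- The language of all encodings of all sets of the family `U`. -/
def encodings (U : Set (Finset ℕ)) : Language Letter :=
  {w | ∃ S ∈ U, IsEncoding S w}

/-! ### Regular realizability -/

/-- A nondeterministic finite automaton over the alphabet `{a, ⊲, ⊳, #}` as a finite object: an
initial state, a list of accepting states and a list of transitions. States are natural numbers;
only finitely many of them occur. -/
structure Automaton where
  start : ℕ
  accept : List ℕ
  trans : List (ℕ × Letter × ℕ)

/-- The automaton as an `NFA`. -/
def Automaton.toNFA (A : Automaton) : NFA Letter ℕ where
  step p x := {q | (p, x, q) ∈ A.trans}
  start := {A.start}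
  accept := {q | q ∈ A.accept}

/-- The alphabet in which automata are described. -/
inductive Code
  | tick
  | comma
  | semicolon
  | letter (x : Letter)
  deriving DecidableEq

/-- The name of a state, in unary. -/
def stateName (q : ℕ) : List Code :=
  List.replicate q Code.tick

/-- The description of an automaton: the initial state, the list of accepting states and the list of
transitions. -/
def Automaton.encode (A : Automaton) : List Code :=
  stateName A.start ++ [Code.semicolon] ++
    A.accept.flatMap (fun q => stateName q ++ [Code.comma]) ++ [Code.semicolon] ++
    A.trans.flatMap (fun t =>
      stateName t.1 ++ [Code.letter t.2.1] ++ stateName t.2.2 ++ [Code.comma])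

/-- The regular realizability problem for the filter `F`: the language of all descriptions of
nondeterministic automata that accept at least one word from `F`. -/
def NRR (F : Language Letter) : Language Code :=
  {w | ∃ A : Automaton, w = A.encode ∧ ∃ u ∈ F, u ∈ A.toNFA.accepts}

end RegReal

/-! A word `x` is represented by a finite set `codeSet x`. The family consists of the codes of the
words of `X` together with every finite set that is not a code. The reduction from `X` sends `x` to
an automaton that accepts a single word, an encoding of `codeSet x`
(`exists_mem_encodings_accepts_chain`). For the converse, polynomially many sets realized by the
automaton are computed. A non-code among them settles the instance positively and is replaced by the
query `d`, a fixed word of `X`. If all of them are codes, they have to exhaust what matters. The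
computation is deterministic, so the NP oracle can be taken empty.

The codes are very rigid. Let `lits x` record the bits of `x` with their positions and an end
marker; inclusion between such sets forces equality of words. The code of `x` is the square of `lits
x`. Given `u` in `lits x` missing from `lits y` and `v` in `lits x` missing from `lits z`, the pair
of `u` and `v` is in the code of `x` but in neither of the other two codes. Thus a code covered by
two codes equals one of them (`eq_or_eq_of_codeSet_subset`), so a union of two codes determines the
two (`IsCode.union_free`). Also, two codes never differ by the exchange of one element
(`eq_of_isCode_insert`).

The exchange property bounds the block lengths (`Reach.exists_mem_family_le`). If an accepted
encoding has a long block, all other blocks are pumped down to length at most the number of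
transitions, and the long one is pumped to two different larger lengths. The two resulting sets are
not both codes, so one of them is in the family and has small elements. What remains is a graph of
polynomial size whose edges are labelled by block lengths, and the question which label sets occur
on walks from the initial to an accepting state.

For two states, `options` lists polynomially many walks that approximate all walks element by
element: an element of the label set of some walk is in some option, and an element missing from it
is missing from some option. The candidates join an option into a state `q` and an option out of
`q`. If all candidates are codes, the unions at `q` form a matrix of codes, and union-freeness makes
it independent of the prefix or independent of the suffix (`constant_of_forall_isCode`). The
approximation property extends this to all walks through `q`. A given walk either starts at a
suffix-independent state, ends at a prefix-independent state, or has an edge from a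
prefix-independent to a suffix-independent state; in each case a candidate has the same label set
(`exists_candidate`).

Polynomial time is obtained by compiling structured stack programs to machines
(`Prog.Runs.evalsToInTime`) and by closing the class `PT` of functions on tree-encoded data under
pairing, case distinction and size-bounded folds (`PT.foldl`). Both reductions are then assembled
from these closure properties. -/

namespace RegReal

/-! ### Structured programs on stacks -/

/-- Structured programs on a family of stacks. `pop k e p` pops a symbol from the stack `k` and
continues with `e` if the stack was empty and with `p b` if the symbol was `b`. `loop k c p` pops
symbols `b` from the stack `k` and runs `p b`, until the stack is empty or `c b` fails. -/
inductive Prog {K : Type} (Γ : K → Type) : Type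
  | skip
  | push (k : K) (b : Γ k)
  | seq (p q : Prog Γ)
  | pop (k : K) (e : Prog Γ) (p : Γ k → Prog Γ)
  | loop (k : K) (c : Γ k → Bool) (p : Γ k → Prog Γ)

namespace Prog

variable {K : Type} {Γ : K → Type}

/-- The positions of a program, which are the labels of the machine that runs it. -/
def Pos : Prog Γ → Type
  | skip => Unit
  | push _ _ => Unit
  | seq p q => Pos p ⊕ Pos q
  | pop k e p => Option (Pos e ⊕ (Σ b : Γ k, Pos (p b)))
  | loop k _ p => Option (Σ b : Γ k, Pos (p b))

/-- The position at which a program starts. -/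
def entry : (p : Prog Γ) → Pos p
  | skip => ()
  | push _ _ => ()
  | seq p _ => Sum.inl (entry p)
  | pop _ _ _ => none
  | loop _ _ _ => none

theorem finite_pos [∀ k, Finite (Γ k)] (p : Prog Γ) : Finite (Pos p) := by
  induction p with
  | skip => exact inferInstanceAs (Finite Unit)
  | push => exact inferInstanceAs (Finite Unit)
  | seq p q hp hq => exact inferInstanceAs (Finite (Pos p ⊕ Pos q))
  | pop k e p he hp => exact inferInstanceAs (Finite (Option (Pos e ⊕ (Σ b : Γ k, Pos (p b)))))
  | loop k c p hp => exact inferInstanceAs (Finite (Option (Σ b : Γ k, Pos (p b))))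

variable [DecidableEq K]

/-- `Runs p S T t`: started on the stacks `S`, the program `p` ends with the stacks `T` within
`t` steps. -/
inductive Runs : Prog Γ → (∀ k, List (Γ k)) → (∀ k, List (Γ k)) → ℕ → Prop
  | skip (S) : Runs skip S S 1
  | push (k b S) : Runs (push k b) S (Function.update S k (b :: S k)) 1
  | seq {p q S T U t u} : Runs p S T t → Runs q T U u → Runs (seq p q) S U (t + u)
  | pop_nil {k e p S T t} : S k = [] → Runs e S T t → Runs (pop k e p) S T (t + 1)
  | pop_cons {k e p S T t b l} : S k = b :: l → Runs (p b) (Function.update S k l) T t →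
      Runs (pop k e p) S T (t + 1)
  | loop_nil {k c p S} : S k = [] → Runs (loop k c p) S S 1
  | loop_exit {k c p S b l} : S k = b :: l → c b = false →
      Runs (loop k c p) S (Function.update S k l) 1
  | loop_step {k c p S T U t u b l} : S k = b :: l → c b = true →
      Runs (p b) (Function.update S k l) T t → Runs (loop k c p) T U u →
      Runs (loop k c p) S U (t + u + 1)
  | mono {p S T t u} : Runs p S T t → t ≤ u → Runs p S T u

/-- The internal states of the machine that runs a program: the symbol popped last. -/
abbrev Popped (Γ : K → Type) : Type := Option (Σ k, Γ k)

/-- The symbol popped last, if it came from the stack `k`. -/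
def Popped.get (k : K) : Popped Γ → Option (Γ k)
  | none => none
  | some ⟨k', b⟩ => if h : k' = k then some (h ▸ b) else none

/-- The code of a program whose positions are embedded into labels by `e` and which ends at the
label `x`. -/
def code {Λ : Type} : (p : Prog Γ) → (Pos p → Λ) → Λ → Pos p → Turing.TM2.Stmt Γ Λ (Popped Γ)
  | skip, _, x, _ => .goto fun _ => x
  | push k b, _, x, _ => .push k (fun _ => b) (.goto fun _ => x)
  | seq p q, e, _, Sum.inl i => code p (fun i => e (Sum.inl i)) (e (Sum.inr (entry q))) i
  | seq _ q, e, x, Sum.inr i => code q (fun i => e (Sum.inr i)) x i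
  | pop k p q, e, _, none => .pop k (fun _ o => o.map (Sigma.mk k)) (.goto fun s =>
      match Popped.get k s with
      | none => e (some (Sum.inl (entry p)))
      | some b => e (some (Sum.inr ⟨b, entry (q b)⟩)))
  | pop _ p _, e, x, some (Sum.inl i) => code p (fun i => e (some (Sum.inl i))) x i
  | pop _ _ q, e, x, some (Sum.inr ⟨b, i⟩) =>
      code (q b) (fun i => e (some (Sum.inr ⟨b, i⟩))) x i
  | loop k c q, e, x, none => .pop k (fun _ o => o.map (Sigma.mk k)) (.goto fun s =>
      match Popped.get k s with
      | none => x
      | some b => if c b then e (some ⟨b, entry (q b)⟩) else x)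
  | loop _ _ q, e, _, some ⟨b, i⟩ => code (q b) (fun i => e (some ⟨b, i⟩)) (e none) i

theorem iterate_bind_trans {σ : Type} {f : σ → Option σ} {a b : σ} {c : Option σ} {m n : ℕ}
    (h₁ : (flip bind f)^[m] (some a) = some b) (h₂ : (flip bind f)^[n] (some b) = c) :
    (flip bind f)^[m + n] (some a) = c := by
  rw [Nat.add_comm, Function.iterate_add_apply, h₁, h₂]

/-- A machine that contains the code of a program simulates every run of the program. -/
theorem Runs.simulate {Λ : Type} {m : Λ → Turing.TM2.Stmt Γ Λ (Popped Γ)}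
    {f : Turing.TM2.Cfg Γ Λ (Popped Γ) → Option (Turing.TM2.Cfg Γ Λ (Popped Γ))}
    (hf : ∀ l v S, f ⟨some l, v, S⟩ = some (Turing.TM2.stepAux (m l) v S))
    {p : Prog Γ} {S T : ∀ k, List (Γ k)} {t : ℕ} (h : Runs p S T t)
    (e : Pos p → Λ) (x : Λ) (hm : ∀ i, m (e i) = code p e x i) (v : Popped Γ) :
    ∃ n ≤ t, ∃ w, (flip bind f)^[n] (some ⟨some (e (entry p)), v, S⟩) = some ⟨some x, w, T⟩ := by
  have one : ∀ {l v S c}, Turing.TM2.stepAux (m l) v S = c →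
      (flip bind f)^[1] (some ⟨some l, v, S⟩) = some c := by
    intro l v S c h
    simp [flip, hf, h]
  induction h generalizing x v with
  | skip S =>
    exact ⟨1, le_rfl, v, one (by rw [hm]; rfl)⟩
  | push k b S =>
    exact ⟨1, le_rfl, v, one (by rw [hm]; rfl)⟩
  | @seq p q S T U t u _ _ hp hq =>
    obtain ⟨n, hn, w, h₁⟩ := hp (fun i => e (Sum.inl i)) (e (Sum.inr (entry q)))
      (fun i => hm (Sum.inl i)) v
    obtain ⟨n', hn', w', h₂⟩ := hq (fun i => e (Sum.inr i)) x (fun i => hm (Sum.inr i)) w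
    exact ⟨n + n', add_le_add hn hn', w', iterate_bind_trans h₁ h₂⟩
  | @pop_nil k p q S T t hk _ hp =>
    obtain ⟨n, hn, w, h₁⟩ := hp (fun i => e (some (Sum.inl i))) x
      (fun i => hm (some (Sum.inl i))) none
    refine ⟨1 + n, by omega, w, iterate_bind_trans (one ?_) h₁⟩
    have hS : Function.update S k [] = S := by rw [← hk, Function.update_eq_self]
    rw [hm]
    simp [code, entry, Turing.TM2.stepAux, hk, Popped.get, hS]
  | @pop_cons k p q S T t b l hk _ hq =>
    obtain ⟨n, hn, w, h₁⟩ := hq (fun i => e (some (Sum.inr ⟨b, i⟩))) x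
      (fun i => hm (some (Sum.inr ⟨b, i⟩))) (some ⟨k, b⟩)
    refine ⟨1 + n, by omega, w, iterate_bind_trans (one ?_) h₁⟩
    rw [hm]
    simp [code, entry, Turing.TM2.stepAux, hk, Popped.get]
  | @loop_nil k c q S hk =>
    refine ⟨1, le_rfl, none, one ?_⟩
    have hS : Function.update S k [] = S := by rw [← hk, Function.update_eq_self]
    rw [hm]
    simp [code, entry, Turing.TM2.stepAux, hk, Popped.get, hS]
  | @loop_exit k c q S b l hk hc =>
    refine ⟨1, le_rfl, some ⟨k, b⟩, one ?_⟩
    rw [hm]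
    simp [code, entry, Turing.TM2.stepAux, hk, Popped.get, hc]
  | @loop_step k c q S T U t u b l hk hc _ _ hq hl =>
    obtain ⟨n, hn, w, h₁⟩ := hq (fun i => e (some ⟨b, i⟩)) (e none)
      (fun i => hm (some ⟨b, i⟩)) (some ⟨k, b⟩)
    obtain ⟨n', hn', w', h₂⟩ := hl e x hm w
    refine ⟨1 + n + n', by omega, w', iterate_bind_trans (iterate_bind_trans (one ?_) h₁) h₂⟩
    rw [hm]
    simp [code, entry, Turing.TM2.stepAux, hk, Popped.get, hc]
  | mono _ hle hp =>
    obtain ⟨n, hn, w, h₁⟩ := hp e x hm v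
    exact ⟨n, hn.trans hle, w, h₁⟩

/-- The machine that runs a program. -/
noncomputable def toTM [Fintype K] [∀ k, Finite (Γ k)] (p : Prog Γ) (k₀ k₁ : K) :
    Turing.FinTM2 where
  K := K
  k₀ := k₀
  k₁ := k₁
  Γ := Γ
  Λ := Option (Pos p)
  main := some (entry p)
  ΛFin := haveI := finite_pos p; Fintype.ofFinite _
  σ := Popped Γ
  initialState := none
  σFin := Fintype.ofFinite _
  Γk₀Fin := Fintype.ofFinite _
  m
    -- The prescribed halting configuration has the initial internal state, so the symbol popped
    -- last is forgotten before halting.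
    | none => .load (fun _ => none) .halt
    | some i => code p some none i

theorem dite_eq_update (k₀ k : K) (x : List (Γ k₀)) :
    (if h : k = k₀ then (by rw [h]; exact x) else [] : List (Γ k)) =
      Function.update (fun _ => []) k₀ x k := by
  by_cases h : k = k₀
  · subst h
    simp
  · simp [h]

theorem initList_toTM [Fintype K] [∀ k, Finite (Γ k)] (p : Prog Γ) (k₀ k₁ : K) (x : List (Γ k₀)) :
    Turing.initList (p.toTM k₀ k₁) x =
      ⟨some (some (entry p)), none, Function.update (fun _ => []) k₀ x⟩ := by
  unfold Turing.initList
  congr 1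
  exact funext fun k => dite_eq_update k₀ k x

theorem haltList_toTM [Fintype K] [∀ k, Finite (Γ k)] (p : Prog Γ) (k₀ k₁ : K) (y : List (Γ k₁)) :
    Turing.haltList (p.toTM k₀ k₁) y =
      ⟨none, none, Function.update (fun _ => []) k₁ y⟩ := by
  unfold Turing.haltList
  congr 1
  exact funext fun k => dite_eq_update k₁ k y

/-- The machine of a program computes what the program computes. The step function is a parameter,
so that the statement also applies to oracle machines without queries. -/
theorem Runs.evalsToInTime [Fintype K] [∀ k, Finite (Γ k)] {p : Prog Γ} {k₀ k₁ : K}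
    {f : (p.toTM k₀ k₁).Cfg → Option (p.toTM k₀ k₁).Cfg}
    (hf : ∀ l v S, f ⟨some l, v, S⟩ = some (Turing.TM2.stepAux ((p.toTM k₀ k₁).m l) v S))
    {x : List (Γ k₀)} {y : List (Γ k₁)} {t : ℕ}
    (h : Runs p (Function.update (fun _ => []) k₀ x) (Function.update (fun _ => []) k₁ y) t)
    {x' : List (Γ k₀)} {y' : List (Γ k₁)} {u : ℕ} (hx : x' = x) (hy : y' = y) (hu : t + 1 ≤ u) :
    Nonempty (StateTransition.EvalsToInTime f (Turing.initList (p.toTM k₀ k₁) x')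
      (some (Turing.haltList (p.toTM k₀ k₁) y')) u) := by
  subst hx hy
  obtain ⟨n, hn, w, h₁⟩ := h.simulate hf some none (fun _ => rfl) none
  refine ⟨⟨⟨n + 1, ?_⟩, (Nat.succ_le_succ hn).trans hu⟩⟩
  rw [initList_toTM, haltList_toTM]
  refine iterate_bind_trans h₁ ?_
  simp only [Function.iterate_one, flip]
  exact hf none w _

end Prog

end RegReal

namespace RegReal

/-! ### Binary trees on a stack -/

/-- The stacks of the machines used below: input, output, and four working stacks of bits. -/
inductive Stk
  | inp
  | out
  | main
  | aux₁
  | aux₂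
  | count
  deriving DecidableEq

instance : Fintype Stk :=
  ⟨{.inp, .out, .main, .aux₁, .aux₂, .count}, fun k => by cases k <;> decide⟩

/-- The alphabets of the stacks. -/
def Sym (I O : Type) : Stk → Type
  | .inp => I
  | .out => O
  | _ => Bool

instance {I O : Type} [Finite I] [Finite O] (k : Stk) : Finite (Sym I O k) := by
  cases k <;> unfold Sym <;> infer_instance

/-- The stacks with the given contents. -/
def stk {I O : Type} (i : List I) (o : List O) (m x y c : List Bool) :
    (k : Stk) → List (Sym I O k)
  | .inp => i
  | .out => o
  | .main => m
  | .aux₁ => x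
  | .aux₂ => y
  | .count => c

section Stacks

variable {I O : Type} (i : List I) (o : List O) (m x y c l : List Bool)

@[simp] theorem update_stk_inp (l : List I) :
    Function.update (stk i o m x y c) .inp l = stk l o m x y c := by
  funext k; cases k <;> rfl

@[simp] theorem update_stk_out (l : List O) :
    Function.update (stk i o m x y c) .out l = stk i l m x y c := by
  funext k; cases k <;> rfl

@[simp] theorem update_stk_main :
    Function.update (stk i o m x y c) .main l = stk i o l x y c := by
  funext k; cases k <;> rfl

@[simp] theorem update_stk_aux₁ :
    Function.update (stk i o m x y c) .aux₁ l = stk i o m l y c := by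
  funext k; cases k <;> rfl

@[simp] theorem update_stk_aux₂ :
    Function.update (stk i o m x y c) .aux₂ l = stk i o m x l c := by
  funext k; cases k <;> rfl

@[simp] theorem update_stk_count :
    Function.update (stk i o m x y c) .count l = stk i o m x y l := by
  funext k; cases k <;> rfl

end Stacks

/-! ### Rules for runs, and moving bits between stacks. -/

namespace Prog

variable {I O : Type} {i : List I} {o : List O} {m x y c : List Bool}

theorem Runs.of_eq {K : Type} [DecidableEq K] {Γ : K → Type} {p : Prog Γ}
    {S T T' : ∀ k, List (Γ k)} {t u : ℕ} (h : Runs p S T t) (hT : T = T') (ht : t ≤ u) :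
    Runs p S T' u :=
  hT ▸ h.mono ht

/-- Push a bit. -/
def pushMain (b : Bool) : Prog (Sym I O) := push .main b

theorem runs_pushMain (b : Bool) :
    Runs (pushMain b) (stk i o m x y c) (stk i o (b :: m) x y c) 1 :=
  (Runs.push (Γ := Sym I O) Stk.main b _).of_eq (update_stk_main ..) le_rfl

theorem runs_pushAux₁ (b : Bool) :
    Runs (push .aux₁ b : Prog (Sym I O)) (stk i o m x y c) (stk i o m (b :: x) y c) 1 :=
  (Runs.push (Γ := Sym I O) Stk.aux₁ b _).of_eq (update_stk_aux₁ ..) le_rfl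

theorem runs_pushAux₂ (b : Bool) :
    Runs (push .aux₂ b : Prog (Sym I O)) (stk i o m x y c) (stk i o m x (b :: y) c) 1 :=
  (Runs.push (Γ := Sym I O) Stk.aux₂ b _).of_eq (update_stk_aux₂ ..) le_rfl

theorem runs_pushCount (b : Bool) :
    Runs (push .count b : Prog (Sym I O)) (stk i o m x y c) (stk i o m x y (b :: c)) 1 :=
  (Runs.push (Γ := Sym I O) Stk.count b _).of_eq (update_stk_count ..) le_rfl

/-- Pop a bit. -/
def popMain : Prog (Sym I O) := pop .main skip fun _ => skip

theorem runs_popMain (b : Bool) :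
    Runs popMain (stk i o (b :: m) x y c) (stk i o m x y c) 2 :=
  Runs.pop_cons (by rfl) ((Runs.skip _).of_eq (by simp) le_rfl)

section Rules

variable {T U : (k : Stk) → List (Sym I O k)} {t u : ℕ} {b : Bool} {cont : Bool → Bool}
  {e : Prog (Sym I O)} {p : Bool → Prog (Sym I O)}

theorem Runs.pop_main (h : Runs (p b) (stk i o m x y c) T t) :
    Runs (pop .main e p) (stk i o (b :: m) x y c) T (t + 1) :=
  Runs.pop_cons (b := b) (l := m) rfl (by rwa [update_stk_main])

theorem Runs.pop_aux₂ (h : Runs (p b) (stk i o m x y c) T t) :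
    Runs (pop .aux₂ e p) (stk i o m x (b :: y) c) T (t + 1) :=
  Runs.pop_cons (b := b) (l := y) rfl (by rwa [update_stk_aux₂])

theorem Runs.pop_count (h : Runs (p b) (stk i o m x y c) T t) :
    Runs (pop .count e p) (stk i o m x y (b :: c)) T (t + 1) :=
  Runs.pop_cons (b := b) (l := c) rfl (by rwa [update_stk_count])

theorem Runs.loop_main (hb : cont b = true) (h : Runs (p b) (stk i o m x y c) T t)
    (h' : Runs (loop .main cont p) T U u) :
    Runs (loop .main cont p) (stk i o (b :: m) x y c) U (t + u + 1) :=
  Runs.loop_step (b := b) (l := m) rfl hb (by rwa [update_stk_main]) h'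

theorem Runs.loop_main_exit (hb : cont b = false) :
    Runs (loop .main cont p) (stk i o (b :: m) x y c) (stk i o m x y c) 1 :=
  (Runs.loop_exit (b := b) (l := m) rfl hb).of_eq (update_stk_main ..) le_rfl

theorem Runs.loop_aux₁ (hb : cont b = true) (h : Runs (p b) (stk i o m x y c) T t)
    (h' : Runs (loop .aux₁ cont p) T U u) :
    Runs (loop .aux₁ cont p) (stk i o m (b :: x) y c) U (t + u + 1) :=
  Runs.loop_step (b := b) (l := x) rfl hb (by rwa [update_stk_aux₁]) h'

theorem Runs.loop_aux₂ (hb : cont b = true) (h : Runs (p b) (stk i o m x y c) T t)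
    (h' : Runs (loop .aux₂ cont p) T U u) :
    Runs (loop .aux₂ cont p) (stk i o m x (b :: y) c) U (t + u + 1) :=
  Runs.loop_step (b := b) (l := y) rfl hb (by rwa [update_stk_aux₂]) h'

theorem Runs.loop_count (hb : cont b = true) (h : Runs (p b) (stk i o m x y c) T t)
    (h' : Runs (loop .count cont p) T U u) :
    Runs (loop .count cont p) (stk i o m x y (b :: c)) U (t + u + 1) :=
  Runs.loop_step (b := b) (l := c) rfl hb (by rwa [update_stk_count]) h'

end Rules

/-- Move everything from `aux₁` to `main`. -/
def pour₁ : Prog (Sym I O) := loop .aux₁ (fun _ => true) fun b => push .main b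

theorem runs_pour₁ : Runs pour₁ (stk i o m x y c) (stk i o (x.reverse ++ m) [] y c)
    (2 * x.length + 1) := by
  induction x generalizing m with
  | nil => exact Runs.loop_nil rfl
  | cons b x ih =>
    exact (Runs.loop_aux₁ rfl (runs_pushMain b) ih).of_eq (by simp) (by simp; omega)

/-- Move everything from `aux₂` to `main`. -/
def pour₂ : Prog (Sym I O) := loop .aux₂ (fun _ => true) fun b => push .main b

theorem runs_pour₂ : Runs pour₂ (stk i o m x y c) (stk i o (y.reverse ++ m) x [] c)
    (2 * y.length + 1) := by
  induction y generalizing m with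
  | nil => exact Runs.loop_nil rfl
  | cons b y ih =>
    exact (Runs.loop_aux₂ rfl (runs_pushMain b) ih).of_eq (by simp) (by simp; omega)

/-- Move everything from `aux₂` to `aux₁`. -/
def pour₂₁ : Prog (Sym I O) := loop .aux₂ (fun _ => true) fun b => push .aux₁ b

theorem runs_pour₂₁ : Runs pour₂₁ (stk i o m x y c) (stk i o m (y.reverse ++ x) [] c)
    (2 * y.length + 1) := by
  induction y generalizing x with
  | nil => exact Runs.loop_nil rfl
  | cons b y ih =>
    exact (Runs.loop_aux₂ rfl (runs_pushAux₁ b) ih).of_eq (by simp) (by simp; omega)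

/-- Move everything from `aux₁` to both `main` and `aux₂`. -/
def split₁ : Prog (Sym I O) :=
  loop .aux₁ (fun _ => true) fun b => seq (push .main b) (push .aux₂ b)

theorem runs_split₁ : Runs split₁ (stk i o m x y c)
    (stk i o (x.reverse ++ m) [] (x.reverse ++ y) c) (3 * x.length + 1) := by
  induction x generalizing m y with
  | nil => exact Runs.loop_nil rfl
  | cons b x ih =>
    exact (Runs.loop_aux₁ rfl ((runs_pushMain b).seq (runs_pushAux₂ b)) ih).of_eq
      (by simp) (by simp; omega)

/-- Erase `aux₁`. -/
def clear₁ : Prog (Sym I O) := loop .aux₁ (fun _ => true) fun _ => skip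

theorem runs_clear₁ : Runs clear₁ (stk i o m x y c) (stk i o m [] y c) (2 * x.length + 1) := by
  induction x with
  | nil => exact Runs.loop_nil rfl
  | cons b x ih =>
    exact (Runs.loop_aux₁ rfl (Runs.skip _) ih).of_eq rfl (by simp; omega)

/-- Erase `count`. -/
def clearCount : Prog (Sym I O) := loop .count (fun _ => true) fun _ => skip

theorem runs_clearCount :
    Runs clearCount (stk i o m x y c) (stk i o m x y []) (2 * c.length + 1) := by
  induction c with
  | nil => exact Runs.loop_nil rfl
  | cons b c ih =>
    exact (Runs.loop_count rfl (Runs.skip _) ih).of_eq rfl (by simp; omega)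

end Prog

/-- Binary trees, the data of the functions considered below. -/
inductive BinTree
  | leaf
  | node (l r : BinTree)

/-- The prefix code of a tree. -/
def BinTree.code : BinTree → List Bool
  | leaf => [false]
  | node l r => true :: (l.code ++ r.code)

/-- Unique readability of the prefix code. It gives injectivity, and hence equality of data can be
tested bit by bit. -/
theorem BinTree.code_append_inj {t s : BinTree} {a b : List Bool}
    (h : t.code ++ a = s.code ++ b) : t = s ∧ a = b := by
  induction t generalizing s a b with
  | leaf => cases s <;> simp_all [code]
  | node l r ihl ihr =>
    cases s with
    | leaf => simp [code] at h
    | node l' r' =>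
      simp only [code, List.cons_append, List.append_assoc, List.cons.injEq, true_and] at h
      obtain ⟨rfl, h₁⟩ := ihl h
      obtain ⟨rfl, h₂⟩ := ihr h₁
      exact ⟨rfl, h₂⟩

theorem BinTree.code_injective : Function.Injective BinTree.code := fun t s h =>
  (code_append_inj (a := []) (b := []) (by rw [h])).1

/-! ### Stack operations on whole trees. -/

namespace Prog

variable {I O : Type} {i : List I} {o : List O} {m x y c : List Bool}

/-- Move the trees counted by `count` from `main` to `aux₁`. -/
def takeTrees₁ : Prog (Sym I O) :=
  loop .count (fun _ => true) fun _ => pop .main skip fun (b : Bool) =>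
    seq (push .aux₁ b) (if b then seq (push .count true) (push .count true) else skip)

/-- The height of `count` is the number of trees still to be read. A node replaces one pending tree
by two and a leaf by none, so no end mark is needed. The remaining run is a hypothesis, which lets
the induction chain the two subtrees of a node; five steps per bit suffice. -/
theorem runs_takeTrees₁ (t : BinTree) {T : (k : Stk) → List (Sym I O k)} {u : ℕ}
    (h : Runs takeTrees₁ (stk i o m (t.code.reverse ++ x) y c) T u) :
    Runs takeTrees₁ (stk i o (t.code ++ m) x y (true :: c)) T (5 * t.code.length + u) := by
  induction t generalizing m x c u with
  | leaf =>
    exact (Runs.loop_count rfl (Runs.pop_main ((runs_pushAux₁ _).seq (Runs.skip _))) h).of_eq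
      rfl (by simp [BinTree.code])
  | node l r ihl ihr =>
    have h₂ := ihl (m := r.code ++ m) (x := true :: x) (c := true :: c)
      (ihr (m := m) (u := u) (c := c) (by simpa [BinTree.code] using h))
    rw [show (l.node r).code ++ m = true :: (l.code ++ (r.code ++ m)) by simp [BinTree.code]]
    refine (Runs.loop_count rfl (Runs.pop_main (m := l.code ++ (r.code ++ m)) ((runs_pushAux₁ _).seq
      ((runs_pushCount true).seq (runs_pushCount true)))) h₂).of_eq rfl ?_
    simp [BinTree.code]; omega

/-- Move a tree from `main` to `aux₁`. -/
def take₁ : Prog (Sym I O) := seq (push .count true) takeTrees₁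

theorem runs_take₁ (t : BinTree) : Runs take₁ (stk i o (t.code ++ m) x y [])
    (stk i o m (t.code.reverse ++ x) y []) (5 * t.code.length + 2) :=
  ((runs_pushCount true).seq (runs_takeTrees₁ t (Runs.loop_nil rfl))).of_eq rfl (by omega)

/-- Move the trees counted by `count` from `main` to `aux₂`. -/
def takeTrees₂ : Prog (Sym I O) :=
  loop .count (fun _ => true) fun _ => pop .main skip fun (b : Bool) =>
    seq (push .aux₂ b) (if b then seq (push .count true) (push .count true) else skip)

theorem runs_takeTrees₂ (t : BinTree) {T : (k : Stk) → List (Sym I O k)} {u : ℕ}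
    (h : Runs takeTrees₂ (stk i o m x (t.code.reverse ++ y) c) T u) :
    Runs takeTrees₂ (stk i o (t.code ++ m) x y (true :: c)) T (5 * t.code.length + u) := by
  induction t generalizing m y c u with
  | leaf =>
    exact (Runs.loop_count rfl (Runs.pop_main ((runs_pushAux₂ _).seq (Runs.skip _))) h).of_eq
      rfl (by simp [BinTree.code])
  | node l r ihl ihr =>
    have h₂ := ihl (m := r.code ++ m) (y := true :: y) (c := true :: c)
      (ihr (m := m) (u := u) (c := c) (by simpa [BinTree.code] using h))
    rw [show (l.node r).code ++ m = true :: (l.code ++ (r.code ++ m)) by simp [BinTree.code]]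
    refine (Runs.loop_count rfl (Runs.pop_main (m := l.code ++ (r.code ++ m)) ((runs_pushAux₂ _).seq
      ((runs_pushCount true).seq (runs_pushCount true)))) h₂).of_eq rfl ?_
    simp [BinTree.code]; omega

/-- Move a tree from `main` to `aux₂`. -/
def take₂ : Prog (Sym I O) := seq (push .count true) takeTrees₂

theorem runs_take₂ (t : BinTree) : Runs take₂ (stk i o (t.code ++ m) x y [])
    (stk i o m x (t.code.reverse ++ y) []) (5 * t.code.length + 2) :=
  ((runs_pushCount true).seq (runs_takeTrees₂ t (Runs.loop_nil rfl))).of_eq rfl (by omega)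

/-- Exchange the two topmost trees. -/
def swap : Prog (Sym I O) := seq take₁ (seq take₂ (seq pour₁ pour₂))

theorem runs_swap (t s : BinTree) :
    Runs swap (stk i o (t.code ++ (s.code ++ m)) [] [] [])
      (stk i o (s.code ++ (t.code ++ m)) [] [] [])
      (7 * (t.code.length + s.code.length) + 6) :=
  ((runs_take₁ t).seq ((runs_take₂ s).seq (runs_pour₁.seq runs_pour₂))).of_eq
    (by simp) (by simp; omega)

/-- Duplicate the topmost tree. -/
def dup : Prog (Sym I O) := seq take₁ (seq split₁ (seq pour₂₁ pour₁))

/-- Each transfer between stacks reverses the word. The copy made on `aux₂` is therefore routed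
through `aux₁`, to arrive on `main` in the right order. -/
theorem runs_dup (t : BinTree) :
    Runs dup (stk i o (t.code ++ m) [] [] []) (stk i o (t.code ++ (t.code ++ m)) [] [] [])
      (12 * t.code.length + 5) :=
  ((runs_take₁ t).seq (runs_split₁.seq (runs_pour₂₁.seq runs_pour₁))).of_eq
    (by simp) (by simp; omega)

/-- Erase the topmost tree. -/
def drop : Prog (Sym I O) := seq take₁ clear₁

theorem runs_drop (t : BinTree) :
    Runs drop (stk i o (t.code ++ m) [] [] []) (stk i o m [] [] []) (7 * t.code.length + 3) :=
  ((runs_take₁ t).seq runs_clear₁).of_eq rfl (by simp; omega)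

/-- Insert a bit below the topmost tree. -/
def insertBelow : Prog (Sym I O) := seq take₁ (seq (pushMain true) pour₁)

theorem runs_insertBelow (t : BinTree) :
    Runs insertBelow (stk i o (t.code ++ m) [] [] []) (stk i o (t.code ++ true :: m) [] [] [])
      (7 * t.code.length + 4) :=
  ((runs_take₁ t).seq ((runs_pushMain true).seq runs_pour₁)).of_eq (by simp) (by simp; omega)

/-- Push a word. -/
def pushWord : List Bool → Prog (Sym I O)
  | [] => skip
  | b :: w => seq (pushWord w) (pushMain b)

theorem runs_pushWord (w : List Bool) :
    Runs (pushWord w) (stk i o m x y c) (stk i o (w ++ m) x y c) (w.length + 1) := by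
  induction w with
  | nil => exact Runs.skip _
  | cons b w ih => exact (ih.seq (runs_pushMain b)).of_eq rfl (by simp)

/-- Record the differences of `aux₁` and `aux₂` on `count`. -/
def compareAux : Prog (Sym I O) :=
  seq
    (loop .aux₁ (fun _ => true) fun (b : Bool) =>
      pop .aux₂ (push .count true) fun (b' : Bool) => if b = b' then skip else push .count true)
    (loop .aux₂ (fun _ => true) fun _ => push .count true)

/-- Every mismatch, and every bit without a partner, leaves a mark on `count`, so equality amounts
to the absence of marks. The length bound pays for erasing the marks afterwards. -/
theorem runs_compareAux : ∃ c', c'.length ≤ x.length + y.length + c.length ∧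
    (c' = [] ↔ c = [] ∧ x = y) ∧
    Runs compareAux (stk i o m x y c) (stk i o m [] [] c') (3 * x.length + 2 * y.length + 2) := by
  have h₂ : ∀ {y c : List Bool}, ∃ c', c'.length ≤ y.length + c.length ∧
      (c' = [] ↔ c = [] ∧ y = []) ∧
      Runs (loop .aux₂ (fun _ => true) fun _ => push .count true : Prog (Sym I O))
        (stk i o m [] y c) (stk i o m [] [] c') (2 * y.length + 1) := by
    intro y
    induction y with
    | nil => exact fun {c} => ⟨c, by simp, by simp, Runs.loop_nil rfl⟩
    | cons b y ih =>
      intro c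
      obtain ⟨c', hl, hc, hr⟩ := ih (c := true :: c)
      have h := Runs.loop_aux₂ (b := b) (cont := fun _ => true) (p := fun _ => push .count true) rfl
        (runs_pushCount true) hr
      exact ⟨c', by simp at hl ⊢; omega, by simp [hc], h.of_eq rfl (by simp; omega)⟩
  have h₁ : ∀ {x y c : List Bool}, ∃ y' c', y'.length ≤ y.length ∧
      y'.length + c'.length ≤ x.length + y.length + c.length ∧
      (c' = [] ∧ y' = [] ↔ c = [] ∧ x = y) ∧
      Runs (loop .aux₁ (fun _ => true) fun (b : Bool) =>
        pop .aux₂ (push .count true) fun (b' : Bool) => if b = b' then skip else push .count true :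
          Prog (Sym I O))
        (stk i o m x y c) (stk i o m [] y' c') (3 * x.length + 1) := by
    intro x
    induction x with
    | nil => exact fun {y c} => ⟨y, c, by simp, by simp, by simp [eq_comm], Runs.loop_nil rfl⟩
    | cons b x ih =>
      intro y c
      cases y with
      | nil =>
        obtain ⟨y', c', hy, hl, hc, hr⟩ := ih (y := []) (c := true :: c)
        refine ⟨y', c', hy, by simp at hl ⊢; omega, by simp [hc],
          (Runs.loop_aux₁ rfl (Runs.pop_nil (S := stk i o m x [] c) rfl (runs_pushCount true)) hr).of_eq rfl
            (by simp; omega)⟩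
      | cons b' y =>
        by_cases hb : b = b'
        · obtain ⟨y', c', hy, hl, hc, hr⟩ := ih (y := y) (c := c)
          refine ⟨y', c', by simp; omega, by simp at hl ⊢; omega, by simp [hc, hb],
            (Runs.loop_aux₁ rfl (Runs.pop_aux₂ (t := 1) (T := stk i o m x y c) ?_) hr).of_eq rfl
              (by simp; omega)⟩
          rw [if_pos hb]
          exact Runs.skip _
        · obtain ⟨y', c', hy, hl, hc, hr⟩ := ih (y := y) (c := true :: c)
          refine ⟨y', c', by simp; omega, by simp at hl ⊢; omega, by simp [hc, hb],
            (Runs.loop_aux₁ rfl (Runs.pop_aux₂ (t := 1) (T := stk i o m x y (true :: c)) ?_)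
              hr).of_eq rfl (by simp; omega)⟩
          rw [if_neg hb]
          exact runs_pushCount true
  obtain ⟨y', c', hy, hl, hc, hr⟩ := h₁ (x := x) (y := y) (c := c)
  obtain ⟨c'', hl', hc', hr'⟩ := h₂ (y := y') (c := c')
  exact ⟨c'', by omega, by rw [hc', hc], (hr.seq hr').of_eq rfl (by omega)⟩

/-- Replace the two topmost trees by the answer to whether they are equal. -/
def compare : Prog (Sym I O) :=
  seq take₁ (seq take₂ (seq compareAux
    (pop .count (pushWord [true, false, false]) fun _ => seq clearCount (pushWord [false]))))

open Classical in
theorem runs_compare (t s : BinTree) :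
    Runs compare (stk i o (t.code ++ (s.code ++ m)) [] [] [])
      (stk i o ((if t = s then [true, false, false] else [false]) ++ m) [] [] [])
      (10 * (t.code.length + s.code.length) + 20) := by
  obtain ⟨c', hl, hc, hr⟩ := runs_compareAux (i := i) (o := o) (m := m)
    (x := t.code.reverse) (y := s.code.reverse) (c := [])
  have hts : t.code.reverse = s.code.reverse ↔ t = s := by
    rw [List.reverse_inj, BinTree.code_injective.eq_iff]
  have h₀ : Runs (pop .count (pushWord [true, false, false]) fun _ =>
      seq clearCount (pushWord [false])) (stk i o m [] [] c')
      (stk i o ((if t = s then [true, false, false] else [false]) ++ m) [] [] [])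
      (2 * c'.length + 5) := by
    cases c' with
    | nil =>
      rw [if_pos (hts.1 (hc.1 rfl).2)]
      exact (Runs.pop_nil rfl (runs_pushWord _)).of_eq rfl (by simp)
    | cons b c' =>
      rw [if_neg (fun h => by have := hc.2 ⟨rfl, hts.2 h⟩; simp at this)]
      exact (Runs.pop_count (runs_clearCount.seq (runs_pushWord _))).of_eq rfl (by simp; omega)
  have h₁ := (runs_take₁ (i := i) (o := o) (m := s.code ++ m) (x := []) (y := []) t).seq
    ((runs_take₂ (i := i) (o := o) (m := m) (x := t.code.reverse ++ []) (y := []) s).seq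
      ((by simpa using hr : Runs compareAux (stk i o m (t.code.reverse ++ [])
        (s.code.reverse ++ []) []) _ (3 * t.code.length + 2 * s.code.length + 2)).seq h₀))
  refine h₁.of_eq rfl ?_
  simp at hl
  omega

end Prog
end RegReal

namespace RegReal

/-! ### Polynomial time functions on types encoded by trees -/

/-- An injective encoding of a type by binary trees. -/
class Enc (α : Type) where
  enc : α → BinTree
  enc_injective : Function.Injective enc

open Enc

/-- The code of `a`. -/
def word {α : Type} [Enc α] (a : α) : List Bool := (enc a).code

/-- The length of the code of `a`. -/
def size {α : Type} [Enc α] (a : α) : ℕ := (word a).length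

instance : Enc Unit := ⟨fun _ => .leaf, fun _ _ _ => rfl⟩

instance : Enc Bool :=
  ⟨fun b => if b then .node .leaf .leaf else .leaf, fun a b => by cases a <;> cases b <;> simp⟩

/-- Natural numbers are encoded in unary. -/
def encNat : ℕ → BinTree
  | 0 => .leaf
  | n + 1 => .node .leaf (encNat n)

theorem encNat_injective : Function.Injective encNat := by
  intro m
  induction m with
  | zero => intro n h; cases n <;> simp_all [encNat]
  | succ m ih =>
    intro n h
    cases n with
    | zero => simp [encNat] at h
    | succ n => simp only [encNat, BinTree.node.injEq, true_and] at h; rw [ih h]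

instance : Enc ℕ := ⟨encNat, encNat_injective⟩

/-- Lists are encoded as right combs. -/
def encList {α : Type} [Enc α] : List α → BinTree
  | [] => .leaf
  | a :: l => .node (enc a) (encList l)

theorem encList_injective {α : Type} [Enc α] : Function.Injective (encList (α := α)) := by
  intro l
  induction l with
  | nil => intro l' h; cases l' <;> simp_all [encList]
  | cons a l ih =>
    intro l' h
    cases l' with
    | nil => simp [encList] at h
    | cons b l' =>
      simp only [encList, BinTree.node.injEq] at h
      rw [enc_injective h.1, ih h.2]

instance {α : Type} [Enc α] : Enc (List α) := ⟨encList, encList_injective⟩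

instance {α β : Type} [Enc α] [Enc β] : Enc (α × β) :=
  ⟨fun p => .node (enc p.1) (enc p.2), fun p q h => by
    simp only [BinTree.node.injEq] at h
    exact Prod.ext (enc_injective h.1) (enc_injective h.2)⟩

/-- An encoding by means of an injective numbering. -/
@[reducible] def Enc.ofNumbering {α : Type} (f : α → ℕ) (hf : Function.Injective f) : Enc α :=
  ⟨fun a => encNat (f a), encNat_injective.comp hf⟩

section Size

variable {α β : Type} [Enc α] [Enc β]

@[simp] theorem length_word (a : α) : (word a).length = size a := rfl

@[simp] theorem word_prod (p : α × β) : word p = true :: (word p.1 ++ word p.2) := rfl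

@[simp] theorem word_nil : word ([] : List α) = [false] := rfl

@[simp] theorem word_cons (a : α) (l : List α) : word (a :: l) = true :: (word a ++ word l) := rfl

@[simp] theorem word_true : word true = [true, false, false] := rfl

@[simp] theorem word_false : word false = [false] := rfl

theorem size_pos (a : α) : 0 < size a := by
  unfold size word
  cases enc a <;> simp [BinTree.code]

@[simp] theorem size_prod (p : α × β) : size p = size p.1 + size p.2 + 1 := by
  simp [← length_word]

@[simp] theorem size_nil : size ([] : List α) = 1 := rfl

@[simp] theorem size_cons (a : α) (l : List α) : size (a :: l) = size a + size l + 1 := by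
  simp [← length_word]

@[simp] theorem size_nat (n : ℕ) : size n = 2 * n + 1 := by
  induction n with
  | zero => rfl
  | succ n ih =>
    have : size (n + 1) = size n + 2 := by simp [size, word, enc, encNat, BinTree.code]
    omega

theorem size_bool_le (b : Bool) : size b ≤ 3 := by
  cases b <;> simp [← length_word]

theorem size_append (l l' : List α) : size (l ++ l') + 1 = size l + size l' := by
  induction l with
  | nil => simp; omega
  | cons a l ih => simp; omega

theorem size_le_of_mem {a : α} {l : List α} (h : a ∈ l) : size a ≤ size l := by
  induction l with
  | nil => simp at h
  | cons b l ih =>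
    simp only [List.mem_cons] at h
    rcases h with rfl | h
    · simp; omega
    · have := ih h; simp; omega

theorem length_le_size (l : List α) : l.length ≤ size l := by
  induction l with
  | nil => simp
  | cons a l ih => simp; omega

theorem size_list_le {l : List α} {n : ℕ} (h : ∀ a ∈ l, size a ≤ n) :
    size l ≤ l.length * (n + 1) + 1 := by
  induction l with
  | nil => simp
  | cons a l ih =>
    have h₁ := ih fun b hb => h b (List.mem_cons_of_mem _ hb)
    have h₂ := h a List.mem_cons_self
    simp only [size_cons, List.length_cons, Nat.add_mul]
    omega

end Size

/-- The function `g` is bounded by a polynomial in the size of its argument. -/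
def PolyBdd {α : Type} [Enc α] (g : α → ℕ) : Prop :=
  ∃ p : Polynomial ℕ, ∀ a, g a ≤ p.eval (size a)

theorem eval_mono (p : Polynomial ℕ) {m n : ℕ} (h : m ≤ n) : p.eval m ≤ p.eval n := by
  rw [Polynomial.eval_eq_sum_range, Polynomial.eval_eq_sum_range]
  gcongr

namespace PolyBdd

variable {α β : Type} [Enc α] [Enc β] {f g : α → ℕ}

theorem const (n : ℕ) : PolyBdd fun _ : α => n := ⟨.C n, fun _ => by simp⟩

theorem size_self : PolyBdd fun a : α => size a := ⟨.X, fun _ => by simp⟩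

theorem add (hf : PolyBdd f) (hg : PolyBdd g) : PolyBdd fun a => f a + g a := by
  obtain ⟨p, hp⟩ := hf
  obtain ⟨q, hq⟩ := hg
  exact ⟨p + q, fun a => by simpa using add_le_add (hp a) (hq a)⟩

theorem mul (hf : PolyBdd f) (hg : PolyBdd g) : PolyBdd fun a => f a * g a := by
  obtain ⟨p, hp⟩ := hf
  obtain ⟨q, hq⟩ := hg
  exact ⟨p * q, fun a => by simpa using Nat.mul_le_mul (hp a) (hq a)⟩

theorem of_le (hg : PolyBdd g) (h : ∀ a, f a ≤ g a) : PolyBdd f := by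
  obtain ⟨p, hp⟩ := hg
  exact ⟨p, fun a => (h a).trans (hp a)⟩

theorem comp {f : β → ℕ} {k : α → β} (hf : PolyBdd f) (hk : PolyBdd fun a => size (k a)) :
    PolyBdd fun a => f (k a) := by
  obtain ⟨p, hp⟩ := hf
  obtain ⟨q, hq⟩ := hk
  exact ⟨p.comp q, fun a => by
    rw [Polynomial.eval_comp]
    exact (hp _).trans (eval_mono p (hq a))⟩

/-- A polynomially bounded function has a polynomial bound that is monotone in the size. -/
theorem exists_mono (hf : PolyBdd f) :
    ∃ p : ℕ → ℕ, (∀ m n, m ≤ n → p m ≤ p n) ∧ (∀ a, f a ≤ p (size a)) ∧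
      ∀ k : β → ℕ, PolyBdd k → PolyBdd fun b => p (k b) := by
  obtain ⟨p, hp⟩ := hf
  refine ⟨fun n => p.eval n, fun _ _ h => eval_mono p h, hp, ?_⟩
  rintro k ⟨q, hq⟩
  exact ⟨p.comp q, fun b => by
    rw [Polynomial.eval_comp]
    exact eval_mono p (hq b)⟩

end PolyBdd

/-- The function `f` is computed in polynomial time by a stack program that replaces the code of
`a` on the top of the main stack by the code of `f a`. -/
def PT {α β : Type} [Enc α] [Enc β] (f : α → β) : Prop :=
  (PolyBdd fun a => size (f a)) ∧
    ∀ I O : Type, ∃ (P : Prog (Sym I O)) (t : α → ℕ), PolyBdd t ∧ ∀ a m i o,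
      P.Runs (stk i o (word a ++ m) [] [] []) (stk i o (word (f a) ++ m) [] [] []) (t a)

section Primitives

open Prog

variable {α β I O : Type} [Enc α] [Enc β] {i : List I} {o : List O} {m : List Bool}

theorem runs_swap_word (a : α) (b : β) :
    Runs swap (stk i o (word a ++ (word b ++ m)) [] [] [])
      (stk i o (word b ++ (word a ++ m)) [] [] []) (7 * (size a + size b) + 6) :=
  runs_swap _ _

theorem runs_dup_word (a : α) :
    Runs dup (stk i o (word a ++ m) [] [] []) (stk i o (word a ++ (word a ++ m)) [] [] [])
      (12 * size a + 5) :=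
  runs_dup _

theorem runs_drop_word (a : α) :
    Runs drop (stk i o (word a ++ m) [] [] []) (stk i o m [] [] []) (7 * size a + 3) :=
  runs_drop _

theorem runs_insertBelow_word (a : α) :
    Runs insertBelow (stk i o (word a ++ m) [] [] []) (stk i o (word a ++ true :: m) [] [] [])
      (7 * size a + 4) :=
  runs_insertBelow _

theorem runs_compare_word [DecidableEq α] (a b : α) :
    Runs compare (stk i o (word a ++ (word b ++ m)) [] [] [])
      (stk i o (word (decide (a = b)) ++ m) [] [] []) (10 * (size a + size b) + 20) := by
  refine (runs_compare (enc a) (enc b)).of_eq ?_ le_rfl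
  by_cases h : a = b
  · simp [h]
  · simp [h, (Enc.enc_injective (α := α)).eq_iff]

end Primitives

/-! ### Closure properties of the polynomial time functions. -/

namespace PT

open Prog

variable {α β γ δ σ : Type} [Enc α] [Enc β] [Enc γ] [Enc δ] [Enc σ]

theorem id : PT fun a : α => a :=
  ⟨.size_self, fun _ _ => ⟨.skip, fun _ => 1, .const 1, fun _ _ _ _ => .skip _⟩⟩

theorem comp {g : β → γ} {f : α → β} (hg : PT g) (hf : PT f) : PT fun a => g (f a) := by
  refine ⟨hg.1.comp hf.1, fun I O => ?_⟩
  obtain ⟨P, t, ht, hP⟩ := hf.2 I O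
  obtain ⟨Q, u, hu, hQ⟩ := hg.2 I O
  exact ⟨P.seq Q, _, ht.add (hu.comp hf.1), fun a m i o => (hP a m i o).seq (hQ (f a) m i o)⟩

/-- Functions that agree on the level of codes. -/
theorem recode {f : α → β} (hf : PT f) {f' : γ → δ} (φ : γ → α) (hφ : ∀ c, enc (φ c) = enc c)
    (hf' : ∀ c, enc (f' c) = enc (f (φ c))) : PT f' := by
  have hs : ∀ c, size (φ c) = size c := fun c => by rw [size, size, word, word, hφ]
  have hφs : PolyBdd fun c => size (φ c) := PolyBdd.size_self.of_le fun c => (hs c).le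
  refine ⟨(hf.1.comp hφs).of_le fun c => by rw [size, size, word, word, hf'], fun I O => ?_⟩
  obtain ⟨P, t, ht, hP⟩ := hf.2 I O
  refine ⟨P, _, ht.comp hφs, fun c m i o => ?_⟩
  rw [word, word, hf', ← hφ]
  exact hP (φ c) m i o

theorem const (b : β) : PT fun _ : α => b := by
  refine ⟨.const _, fun I O => ⟨.seq drop (pushWord (word b)), _,
    ((PolyBdd.const 7).mul .size_self).add (.const (3 + (size b + 1))), fun a m i o => ?_⟩⟩
  exact ((runs_drop_word a).seq (runs_pushWord _)).of_eq rfl (by simp; omega)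

theorem pair {f : α → β} {g : α → γ} (hf : PT f) (hg : PT g) : PT fun a => (f a, g a) := by
  refine ⟨((hf.1.add hg.1).add (.const 1)).of_le fun a => by simp, fun I O => ?_⟩
  obtain ⟨P, t, ht, hP⟩ := hf.2 I O
  obtain ⟨Q, u, hu, hQ⟩ := hg.2 I O
  refine ⟨.seq dup (.seq P (.seq swap (.seq Q (.seq swap (pushMain true))))), _,
    (((PolyBdd.const 12).mul .size_self).add (.const 5)).add (ht.add
      ((((PolyBdd.const 7).mul (hf.1.add .size_self)).add (.const 6)).add (hu.add
        ((((PolyBdd.const 7).mul (hf.1.add hg.1)).add (.const 6)).add (.const 1))))),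
    fun a m i o => ?_⟩
  refine ((runs_dup_word a).seq ((hP a _ i o).seq ((runs_swap_word (f a) a).seq
    ((hQ a _ i o).seq ((runs_swap_word (g a) (f a)).seq (runs_pushMain true)))))).of_eq ?_ ?_
  · simp
  · omega

theorem of_fst : PT fun p : α × β => p.1 := by
  refine ⟨PolyBdd.size_self.of_le fun p => by simp; omega, fun I O =>
    ⟨.seq popMain (.seq swap drop), _,
      ((PolyBdd.const 14).mul .size_self).add (.const 20), fun p m i o => ?_⟩⟩
  rw [word_prod, List.cons_append, List.append_assoc]
  exact ((runs_popMain true).seq ((runs_swap_word p.1 p.2).seq (runs_drop_word p.2))).of_eq rfl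
    (by simp; omega)

theorem of_snd : PT fun p : α × β => p.2 := by
  refine ⟨PolyBdd.size_self.of_le fun p => by simp; omega, fun I O =>
    ⟨.seq popMain drop, _,
      ((PolyBdd.const 14).mul .size_self).add (.const 20), fun p m i o => ?_⟩⟩
  rw [word_prod, List.cons_append, List.append_assoc]
  exact ((runs_popMain true).seq (runs_drop_word p.1)).of_eq rfl (by simp; omega)

theorem fst {f : α → β × γ} (hf : PT f) : PT fun a => (f a).1 := of_fst.comp hf

theorem snd {f : α → β × γ} (hf : PT f) : PT fun a => (f a).2 := of_snd.comp hf

theorem cond {c : α → Bool} {f g : α → β} (hc : PT c) (hf : PT f) (hg : PT g) :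
    PT fun a => bif c a then f a else g a := by
  refine ⟨(hf.1.add hg.1).of_le fun a => by cases h : c a <;> simp [h], fun I O => ?_⟩
  obtain ⟨R, v, hv, hR⟩ := (hc.pair PT.id).2 I O
  obtain ⟨P, t, ht, hP⟩ := hf.2 I O
  obtain ⟨Q, u, hu, hQ⟩ := hg.2 I O
  refine ⟨.seq R (.seq popMain (.pop .main .skip fun b : Bool =>
    if b then .seq popMain (.seq popMain P) else Q)), _,
    hv.add ((PolyBdd.const 7).add (ht.add hu)), fun a m i o => ?_⟩
  have h := hR a m i o
  cases hb : c a
  · simp only [hb, cond_false] at h ⊢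
    exact (h.seq ((runs_popMain true).seq (Runs.pop_main (T := stk i o (word (g a) ++ m) [] [] [])
      (t := u a) (hQ a m i o)))).of_eq rfl (by omega)
  · simp only [hb, cond_true] at h ⊢
    exact (h.seq ((runs_popMain true).seq (Runs.pop_main (T := stk i o (word (f a) ++ m) [] [] [])
      (t := 2 + (2 + t a)) ((runs_popMain false).seq
        ((runs_popMain false).seq (hP a m i o)))))).of_eq rfl (by omega)

theorem ite {c : α → Prop} [DecidablePred c] {f g : α → β} (hc : PT fun a => decide (c a))
    (hf : PT f) (hg : PT g) : PT fun a => if c a then f a else g a := by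
  simpa [Bool.cond_decide] using hc.cond hf hg

theorem of_decide_eq [DecidableEq α] : PT fun p : α × α => decide (p.1 = p.2) := by
  refine ⟨(PolyBdd.const 3).of_le fun p => size_bool_le _, fun I O =>
    ⟨.seq popMain compare, _, ((PolyBdd.const 10).mul .size_self).add (.const 30),
      fun p m i o => ?_⟩⟩
  rw [word_prod, List.cons_append, List.append_assoc]
  exact ((runs_popMain true).seq (runs_compare_word p.1 p.2)).of_eq rfl (by simp; omega)

theorem decide_eq [DecidableEq β] {f g : α → β} (hf : PT f) (hg : PT g) :
    PT fun a => decide (f a = g a) :=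
  of_decide_eq.comp (hf.pair hg)

theorem not {f : α → Bool} (hf : PT f) : PT fun a => !f a := by
  have h := hf.cond (const (α := α) false) (const true)
  convert h using 2 with a
  cases f a <;> rfl

theorem and {f g : α → Bool} (hf : PT f) (hg : PT g) : PT fun a => f a && g a := by
  have h := hf.cond hg (const (α := α) false)
  convert h using 2 with a
  cases f a <;> rfl

theorem cons {f : α → β} {g : α → List β} (hf : PT f) (hg : PT g) : PT fun a => f a :: g a :=
  (hf.pair hg).recode (fun a => a) (fun _ => rfl) fun _ => rfl

theorem of_isEmpty : PT fun l : List α => l.isEmpty := by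
  refine ⟨(PolyBdd.const 3).of_le fun p => size_bool_le _, fun I O =>
    ⟨.pop .main .skip fun b : Bool => if b then .seq drop (.seq drop (pushWord [false]))
      else pushWord [true, false, false], _,
      ((PolyBdd.const 7).mul .size_self).add (.const 30), fun l m i o => ?_⟩⟩
  cases l with
  | nil => exact (Runs.pop_main (runs_pushWord _)).of_eq rfl (by simp)
  | cons a l =>
    rw [word_cons, List.cons_append, List.append_assoc]
    exact (Runs.pop_main ((runs_drop_word a).seq
      ((runs_drop_word l).seq (runs_pushWord [false])))).of_eq rfl (by simp; omega)

theorem isEmpty {f : α → List β} (hf : PT f) : PT fun a => (f a).isEmpty := of_isEmpty.comp hf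

theorem of_tail : PT fun l : List α => l.tail := by
  refine ⟨PolyBdd.size_self.of_le fun l => by cases l <;> simp; omega, fun I O =>
    ⟨.pop .main .skip fun b : Bool => if b then drop else pushWord [false], _,
      ((PolyBdd.const 7).mul .size_self).add (.const 30), fun l m i o => ?_⟩⟩
  cases l with
  | nil => exact (Runs.pop_main (runs_pushWord _)).of_eq rfl (by simp)
  | cons a l =>
    rw [word_cons, List.cons_append, List.append_assoc]
    exact (Runs.pop_main (runs_drop_word a)).of_eq rfl (by simp; omega)

theorem tail {f : α → List β} (hf : PT f) : PT fun a => (f a).tail := of_tail.comp hf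

theorem of_headI [Inhabited α] : PT fun l : List α => l.headI := by
  refine ⟨(PolyBdd.size_self.add (.const (size (default : α)))).of_le fun l => by
      cases l <;> simp; omega, fun I O =>
    ⟨.pop .main .skip fun b : Bool => if b then .seq swap drop else pushWord (word (default : α)), _,
      ((PolyBdd.const 14).mul .size_self).add (.const (30 + size (default : α))),
      fun l m i o => ?_⟩⟩
  cases l with
  | nil => exact (Runs.pop_main (runs_pushWord _)).of_eq rfl (by simp; omega)
  | cons a l =>
    rw [word_cons, List.cons_append, List.append_assoc]
    exact (Runs.pop_main ((runs_swap_word a l).seq (runs_drop_word l))).of_eq rfl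
      (by simp; omega)

theorem headI [Inhabited β] {f : α → List β} (hf : PT f) : PT fun a => (f a).headI :=
  of_headI.comp hf

/-- The program of a fold: the list is on the top of the state. -/
def foldProg {I O : Type} (P : Prog (Sym I O)) : Prog (Sym I O) :=
  .loop .main (fun b : Bool => b) fun _ =>
    .seq swap (.seq insertBelow (.seq swap (.seq P swap)))

/-- The loop pops the constructor bit of the list, which leaves head, tail and state on the stack.
Moving the tail to the top and inserting a node bit below it turns head and state into a pair, on
which `P` can run after another swap. The four moves around `P` cost seven steps per bit, whence the
factor 28; `N` bounds the cost of any single round. -/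
theorem runs_foldProg {I O : Type} {P : Prog (Sym I O)} {g : α × σ → σ} {t : α × σ → ℕ}
    (hP : ∀ a m i o, P.Runs (stk i o (word a ++ m) [] [] []) (stk i o (word (g a) ++ m) [] [] [])
      (t a)) {N : ℕ} (l : List α) (s : σ) (m : List Bool) (i : List I) (o : List O)
    (hN : ∀ l₁ a l₂, l = l₁ ++ a :: l₂ → 28 * (size l + size (l₁.foldl (fun s a => g (a, s)) s) +
      size ((l₁ ++ [a]).foldl (fun s a => g (a, s)) s)) + 40 +
      t (a, l₁.foldl (fun s a => g (a, s)) s) ≤ N) :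
    (foldProg P).Runs (stk i o (word l ++ (word s ++ m)) [] [] [])
      (stk i o (word (l.foldl (fun s a => g (a, s)) s) ++ m) [] [] []) (l.length * N + 1) := by
  induction l generalizing s with
  | nil => exact (Runs.loop_main_exit rfl).of_eq rfl (by simp)
  | cons a l ih =>
    have h₀ := hN [] a l rfl
    have ih' := ih (g (a, s)) fun l₁ b l₂ h => by
      have h' := hN (a :: l₁) b l₂ (by rw [h]; rfl)
      simp only [size_cons, List.foldl_cons, List.cons_append] at h'
      omega
    have h₁ := hP (a, s) (word l ++ m) i o
    simp only [word_prod, List.cons_append, List.append_assoc] at h₁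
    have h₂ := runs_swap_word (i := i) (o := o) (m := m) l (a, s)
    simp only [word_prod, List.cons_append, List.append_assoc] at h₂
    rw [word_cons, List.cons_append, List.append_assoc]
    refine (Runs.loop_main rfl ((runs_swap_word a l).seq ((runs_insertBelow_word l).seq
      (h₂.seq (h₁.seq (runs_swap_word (g (a, s)) l))))) ih').of_eq rfl ?_
    simp only [size_cons, List.foldl_cons, List.foldl_nil, List.nil_append, size_prod] at h₀ ⊢
    simp only [List.length_cons, Nat.add_mul]
    omega

/-- A fold is computed in polynomial time if all intermediate states have polynomial size. -/
theorem foldl {l : α → List β} {s : α → σ} {g : α → σ → β → σ} (hl : PT l) (hs : PT s)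
    (hg : PT fun p : α × σ × β => g p.1 p.2.1 p.2.2) {B : α → ℕ} (hB : PolyBdd B)
    (h : ∀ a l', l' <+: l a → size (l'.foldl (g a) (s a)) ≤ B a) :
    PT fun a => (l a).foldl (g a) (s a) := by
  refine ⟨hB.of_le fun a => h a _ List.prefix_rfl, fun I O => ?_⟩
  -- One round sees only the current element and the state. The parameter `a` therefore travels in
  -- the state and is projected away at the end.
  have hg' : PT fun p : β × α × σ => (p.2.1, g p.2.1 p.2.2 p.1) :=
    pair (fst (snd PT.id)) (hg.comp (pair (fst (snd PT.id)) (pair (snd (snd PT.id)) (fst PT.id))))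
  obtain ⟨P, t, ht, hP⟩ := hg'.2 I O
  obtain ⟨Q, u, hu, hQ⟩ := (hl.pair (PT.id.pair hs)).2 I O
  obtain ⟨R, v, hv, hR⟩ := (of_snd (α := α) (β := σ)).2 I O
  obtain ⟨p, hpm, hp, hpB⟩ := ht.exists_mono (β := α)
  obtain ⟨q, hqm, hq, hqB⟩ := hv.exists_mono (β := α)
  have hf : ∀ (a : α) (l' : List β), l'.foldl (fun (s : α × σ) b => (s.1, g s.1 s.2 b)) (a, s a) =
      (a, l'.foldl (g a) (s a)) := by
    intro a l'
    induction l' using List.reverseRecOn with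
    | nil => rfl
    | append_singleton l' b ih => simp only [List.foldl_append, ih, List.foldl_cons, List.foldl_nil]
  have hs₁ : PolyBdd fun a => size a + B a + 1 := (PolyBdd.size_self.add hB).add (.const 1)
  have hs₂ : PolyBdd fun a => size (l a) + (size a + B a + 1) + 1 := (hl.1.add hs₁).add (.const 1)
  have hN : PolyBdd fun a => 28 * (size (l a) + (size a + B a + 1) + (size a + B a + 1)) + 40 +
      p (size (l a) + (size a + B a + 1) + 1) :=
    ((((PolyBdd.const 28).mul ((hl.1.add hs₁).add hs₁))).add (.const 40)).add (hpB _ hs₂)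
  refine ⟨.seq Q (.seq popMain (.seq (foldProg P) R)), _,
    hu.add ((PolyBdd.const 2).add (((hl.1.mul hN).add (.const 1)).add (hqB _ hs₁))),
    fun a m i o => ?_⟩
  have h₁ := hQ a m i o
  rw [word_prod, List.cons_append, List.append_assoc] at h₁
  have h₂ := runs_foldProg hP (l a) (a, s a) m i o
    (N := 28 * (size (l a) + (size a + B a + 1) + (size a + B a + 1)) + 40 +
      p (size (l a) + (size a + B a + 1) + 1)) (by
    intro l₁ b l₂ hab
    simp only [hf, size_prod]
    have e₁ := h a l₁ (hab ▸ List.prefix_append _ _)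
    have e₂ := h a (l₁ ++ [b]) (hab ▸ ⟨l₂, by simp⟩)
    have e₃ : size b ≤ size (l a) := size_le_of_mem (by simp [hab])
    have e₄ := (hp (b, a, l₁.foldl (g a) (s a))).trans
      (hpm _ (size (l a) + (size a + B a + 1) + 1) (by simp only [size_prod]; omega))
    omega)
  simp only [hf] at h₂
  have h₃ := hR (a, (l a).foldl (g a) (s a)) m i o
  have e₀ := (hq (a, (l a).foldl (g a) (s a))).trans (hqm _ (size a + B a + 1)
    (by simpa using h a _ List.prefix_rfl))
  refine (h₁.seq ((runs_popMain true).seq (h₂.seq h₃))).of_eq rfl ?_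
  have := Nat.mul_le_mul_right (28 * (size (l a) + (size a + B a + 1) + (size a + B a + 1)) + 40 +
    p (size (l a) + (size a + B a + 1) + 1)) (length_le_size (l a))
  omega

end PT
end RegReal

namespace RegReal

open Enc

/-! ### Lists and unary numbers -/

section Size

variable {α β : Type} [Enc β]

@[simp] theorem size_reverse [Enc α] (l : List α) : size l.reverse = size l := by
  induction l with
  | nil => rfl
  | cons a l ih =>
    have := size_append l.reverse [a]
    simp only [List.reverse_cons, size_cons, size_nil] at this ⊢
    omega

theorem size_le_of_prefix [Enc α] {l l' : List α} (h : l' <+: l) : size l' ≤ size l := by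
  obtain ⟨t, rfl⟩ := h
  have := size_append l' t
  have := size_pos t
  omega

theorem size_flatMap_le {f : α → List β} {l : List α} {n : ℕ} (h : ∀ a ∈ l, size (f a) ≤ n) :
    size (l.flatMap f) ≤ l.length * n + 1 := by
  induction l with
  | nil => simp
  | cons a l ih =>
    have h₁ := ih fun b hb => h b (List.mem_cons_of_mem _ hb)
    have h₂ := h a List.mem_cons_self
    have h₃ := size_append (f a) (l.flatMap f)
    simp only [List.flatMap_cons, List.length_cons, Nat.add_mul]
    omega

end Size

namespace PT

variable {α β γ δ σ : Type} [Enc α] [Enc β] [Enc γ] [Enc δ] [Enc σ]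

theorem reverse {f : α → List β} (hf : PT f) : PT fun a => (f a).reverse := by
  have h := foldl (g := fun _ s b => b :: s) hf (const (α := α) ([] : List β))
    (cons (snd (snd PT.id)) (fst (snd PT.id))) hf.1 fun a l' hl => by
      simpa using size_le_of_prefix hl
  simpa using h

theorem append {f g : α → List β} (hf : PT f) (hg : PT g) : PT fun a => f a ++ g a := by
  have h := foldl (g := fun _ s b => b :: s) hf.reverse hg
    (cons (snd (snd PT.id)) (fst (snd PT.id))) (hf.1.add hg.1) fun a l' hl => by
      have h₁ := size_le_of_prefix hl
      have h₂ := size_append l'.reverse (g a)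
      simp only [size_reverse, List.foldl_flip_cons_eq_append] at h₁ h₂ ⊢
      simp at h₂ ⊢
      omega
  simpa using h

/-- A fold that appends. Elements of the list are no larger than the list itself, so one value of
the polynomial for `f` bounds all the pieces. -/
theorem flatMap {l : α → List β} {f : α → β → List γ} (hl : PT l)
    (hf : PT fun p : α × β => f p.1 p.2) : PT fun a => (l a).flatMap (f a) := by
  obtain ⟨p, hpm, hp, hpB⟩ := hf.1.exists_mono (β := α)
  have hB : PolyBdd fun a => size (l a) * p (size a + size (l a) + 1) + 1 :=
    (hl.1.mul (hpB _ ((PolyBdd.size_self.add hl.1).add (.const 1)))).add (.const 1)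
  have e : ∀ (a : α) (l' : List β), l'.foldl (fun s b => s ++ f a b) [] = l'.flatMap (f a) := by
    intro a l'
    induction l' using List.reverseRecOn with
    | nil => rfl
    | append_singleton l' b ih => simp [ih]
  have h := foldl (g := fun a s b => s ++ f a b) hl (const (α := α) ([] : List γ))
    (append (fst (snd PT.id)) (hf.comp (pair (fst PT.id) (snd (snd PT.id))))) hB fun a l' hl' => by
      rw [e]
      refine (size_flatMap_le (n := p (size a + size (l a) + 1)) fun b hb => ?_).trans ?_
      · refine (hp (a, b)).trans (hpm _ _ ?_)
        have := size_le_of_mem (hl'.subset hb)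
        simp only [size_prod]
        omega
      · have := Nat.mul_le_mul_right (p (size a + size (l a) + 1))
          (hl'.length_le.trans (length_le_size (l a)))
        omega
  simpa [e] using h

theorem map {l : α → List β} {f : α → β → γ} (hl : PT l) (hf : PT fun p : α × β => f p.1 p.2) :
    PT fun a => (l a).map (f a) := by
  have h := hl.flatMap (f := fun a b => [f a b]) (hf.cons (const []))
  simpa [List.flatMap_singleton', ← List.map_eq_flatMap] using h

theorem filter {l : α → List β} {c : α → β → Bool} (hl : PT l)
    (hc : PT fun p : α × β => c p.1 p.2) : PT fun a => (l a).filter (c a) := by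
  have h := hl.flatMap (f := fun a b => bif c a b then [b] else [])
    (hc.cond ((snd PT.id).cons (const [])) (const []))
  convert h using 2 with a
  induction l a with
  | nil => rfl
  | cons b l ih => cases hb : c a b <;> simp [hb, ih]

theorem any {l : α → List β} {c : α → β → Bool} (hl : PT l)
    (hc : PT fun p : α × β => c p.1 p.2) : PT fun a => (l a).any (c a) := by
  convert (hl.filter hc).isEmpty.not using 2 with a
  induction l a with
  | nil => rfl
  | cons b l ih => cases hb : c a b <;> simp [hb, ih]

theorem all {l : α → List β} {c : α → β → Bool} (hl : PT l)
    (hc : PT fun p : α × β => c p.1 p.2) : PT fun a => (l a).all (c a) := by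
  convert (hl.any (c := fun a b => !c a b) hc.not).not using 2 with a
  induction l a with
  | nil => rfl
  | cons b l ih => cases hb : c a b <;> simp [hb, ih]

theorem decide_mem [DecidableEq β] {f : α → β} {l : α → List β} (hf : PT f) (hl : PT l) :
    PT fun a => decide (f a ∈ l a) := by
  convert hl.any (c := fun a b => decide (f a = b))
    (decide_eq (hf.comp (fst PT.id)) (snd PT.id)) using 2 with a
  induction l a with
  | nil => rfl
  | cons b l ih => simp [ih]

/-- A unary number and a list of units have the same code. Hence lengths, sums, products and counted
repetitions are list operations. -/
theorem encList_replicate (n : ℕ) : enc (List.replicate n ()) = enc n := by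
  induction n with
  | zero => rfl
  | succ n ih =>
    change BinTree.node _ _ = BinTree.node _ _
    exact congrArg _ ih

theorem units {f : α → ℕ} (hf : PT f) : PT fun a => List.replicate (f a) () :=
  hf.recode (fun a => a) (fun _ => rfl) fun _ => encList_replicate _

theorem length_units {f : α → List Unit} (hf : PT f) : PT fun a => (f a).length := by
  refine hf.recode (fun a => a) (fun _ => rfl) fun a => ?_
  rw [← encList_replicate]
  congr 1
  exact (List.eq_replicate_iff.2 ⟨rfl, fun _ _ => rfl⟩).symm

theorem length {f : α → List β} (hf : PT f) : PT fun a => (f a).length := by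
  simpa using length_units (hf.map (f := fun _ _ => ()) (const ()))

theorem add {f g : α → ℕ} (hf : PT f) (hg : PT g) : PT fun a => f a + g a := by
  simpa using length_units (hf.units.append hg.units)

theorem mul {f g : α → ℕ} (hf : PT f) (hg : PT g) : PT fun a => f a * g a := by
  simpa using length_units (hf.units.flatMap (f := fun a _ => List.replicate (g a) ())
    (hg.units.comp (fst PT.id)))

theorem replicate {f : α → ℕ} {g : α → β} (hf : PT f) (hg : PT g) :
    PT fun a => List.replicate (f a) (g a) := by
  simpa using hf.units.map (f := fun a _ => g a) (hg.comp (fst PT.id))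

theorem range {f : α → ℕ} (hf : PT f) : PT fun a => List.range (f a) := by
  have e : ∀ l : List Unit,
      l.foldl (fun (s : List ℕ) _ => s ++ [s.length]) [] = List.range l.length := by
    intro l
    induction l using List.reverseRecOn with
    | nil => rfl
    | append_singleton l b ih => simp [ih, List.range_succ]
  have hB : PolyBdd fun a => size (f a) * (size (f a) + 1) + 1 :=
    (hf.1.mul (hf.1.add (.const 1))).add (.const 1)
  have h := foldl (g := fun _ s _ => s ++ [s.length]) hf.units (const (α := α) ([] : List ℕ))
    (append (fst (snd PT.id)) ((length (fst (snd PT.id))).cons (const []))) hB fun a l' hl => by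
      rw [e]
      have hl' := hl.length_le
      simp only [List.length_replicate] at hl'
      refine (size_list_le (n := size (f a)) fun k hk => ?_).trans ?_
      · simp only [List.mem_range] at hk
        simp only [size_nat]
        omega
      · have := Nat.mul_le_mul_right (size (f a) + 1)
          (show l'.length ≤ size (f a) by simp only [size_nat]; omega)
        simp only [List.length_range]
        omega
  simpa [e] using h

end PT

/-! ### From stack programs to machines -/

namespace Prog

variable {I O : Type} {i : List I} {o : List O} {m x y c : List Bool}

/-- Push a word to `aux₁`, first symbol first. -/
def pushSeq₁ : List Bool → Prog (Sym I O)
  | [] => skip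
  | b :: w => seq (push .aux₁ b) (pushSeq₁ w)

theorem runs_pushSeq₁ (w : List Bool) :
    Runs (pushSeq₁ w) (stk i o m x y c) (stk i o m (w.reverse ++ x) y c) (w.length + 1) := by
  induction w generalizing x with
  | nil => exact Runs.skip _
  | cons b w ih => exact ((runs_pushAux₁ b).seq ih).of_eq (by simp) (by simp; omega)

/-- Move the input to the main stack. -/
def readInput [Enc I] : Prog (Sym I O) :=
  seq (loop .inp (fun _ => true) fun a : I => pushSeq₁ (true :: word a))
    (seq (pushMain false) pour₁)

/-- The input symbols come in list order, each preceded by a constructor bit, and pile up in reverse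
on `aux₁`. The bit `false` pushed on `main` before the final pouring is the code of the empty tail.
-/
theorem runs_readInput [Enc I] : Runs readInput (stk i o [] [] [] [])
    (stk [] o (word i) [] [] []) (5 * size i + 5) := by
  have h : ∀ {x : List Bool}, ∃ w : List Bool, w ++ [false] = word i ∧
      Runs (loop .inp (fun _ => true) fun a : I => pushSeq₁ (true :: word a) : Prog (Sym I O))
        (stk i o [] x [] []) (stk [] o [] (w.reverse ++ x) [] []) (3 * size i) := by
    induction i with
    | nil => exact fun {x} => ⟨[], rfl, Runs.mono (Runs.loop_nil rfl) (by simp)⟩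
    | cons a i ih =>
      intro x
      obtain ⟨w, hw, hr⟩ := ih (x := (true :: word a).reverse ++ x)
      refine ⟨true :: word a ++ w, by simp [← hw], ?_⟩
      have h₁ := runs_pushSeq₁ (i := i) (o := o) (m := []) (x := x) (y := []) (c := [])
        (true :: word a)
      have h₂ := Runs.loop_step (k := Stk.inp) (c := fun _ => true)
        (S := stk (a :: i) o [] x [] []) (b := a) (l := i)
        (p := fun a : I => pushSeq₁ (true :: word a)) rfl rfl
        (by rw [update_stk_inp]; exact h₁) hr
      have := size_pos a
      exact h₂.of_eq (by simp) (by simp; omega)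
  obtain ⟨w, hw, hr⟩ := h (x := [])
  have hl : w.length + 1 = size i := by rw [size, ← hw]; simp
  exact (hr.seq ((runs_pushMain false).seq runs_pour₁)).of_eq (by simp [hw]) (by simp; omega)

/-- Move a symbol, given by its number in a list, from the main stack to the output. -/
def writeSymbol : List O → Prog (Sym I O)
  | [] => skip
  | a :: l => pop .main skip fun b : Bool =>
      if b then seq popMain (writeSymbol l) else push .out a

theorem runs_writeSymbol {l : List O} {k : ℕ} {a : O} (h : l[k]? = some a) :
    Runs (writeSymbol l) (stk i o ((encNat k).code ++ m) x y c) (stk i (a :: o) m x y c)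
      (3 * l.length) := by
  induction l generalizing k with
  | nil => simp at h
  | cons b l ih =>
    cases k with
    | zero =>
      simp only [List.getElem?_cons_zero, Option.some.injEq] at h
      subst h
      exact (Runs.pop_main ((Runs.push (Γ := Sym I O) Stk.out b _).of_eq (update_stk_out ..)
        le_rfl)).of_eq rfl (by simp; omega)
    | succ k =>
      simp only [List.getElem?_cons_succ] at h
      exact (Runs.pop_main ((runs_popMain false).seq (ih h))).of_eq rfl (by simp; omega)

/-- Move a list from the main stack to the output, in reverse order. -/
def writeOutput (l : List O) : Prog (Sym I O) :=
  loop .main (fun b : Bool => b) fun _ => writeSymbol l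

/-- Symbols are encoded by their positions in `l`, so a symbol is recognized by counting along `l`.
The order is reversed, which is compensated by running this on a reversed list. -/
theorem runs_writeOutput [Enc O] {l : List O} (hl : ∀ a : O, ∃ k, l[k]? = some a ∧ enc a = encNat k)
    (w : List O) : Runs (writeOutput l) (stk i o (word w) [] [] [])
      (stk i (w.reverse ++ o) [] [] [] []) (w.length * (3 * l.length + 1) + 1) := by
  induction w generalizing o with
  | nil => exact (Runs.loop_main_exit rfl).of_eq rfl (by simp)
  | cons a w ih =>
    obtain ⟨k, hk, ha⟩ := hl a
    rw [word_cons]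
    have h := runs_writeSymbol (i := i) (o := o) (m := word w) (x := []) (y := []) (c := []) hk
    rw [← ha] at h
    refine (Runs.loop_main rfl h ih).of_eq (by simp) ?_
    simp only [List.length_cons, Nat.add_mul]
    omega

end Prog

theorem stk_eq_update_inp {I O : Type} (i : List I) :
    stk (O := O) i [] [] [] [] [] =
      Function.update (fun k => ([] : List (Sym I O k))) Stk.inp i := by
  funext k; cases k <;> rfl

theorem stk_eq_update_out {I O : Type} (o : List O) :
    stk (I := I) [] o [] [] [] [] =
      Function.update (fun k => ([] : List (Sym I O k))) Stk.out o := by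
  funext k; cases k <;> rfl

open Prog in
theorem PT.exists_prog {I O : Type} [Enc I] [Enc O] [Finite I] {f : List I → List O} (hf : PT f)
    {l : List O} (hl : ∀ a : O, ∃ k, l[k]? = some a ∧ enc a = encNat k) :
    ∃ (P : Prog (Sym I O)) (p : Polynomial ℕ), ∀ x : List I,
      P.Runs (Function.update (fun _ => []) .inp x) (Function.update (fun _ => []) .out (f x))
        (p.eval x.length) := by
  obtain ⟨P, t, ht, hP⟩ := hf.reverse.2 I O
  obtain ⟨q, hq⟩ := (((PolyBdd.const 5).mul PolyBdd.size_self).add (.const 5)).add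
    (ht.add ((hf.1.mul (.const (3 * l.length + 1))).add (.const 1)))
  -- Since the input alphabet is finite, the size of the encoded input is linear in the number of
  -- its symbols, so the bound can be rewritten in terms of the input length.
  obtain ⟨C, hC⟩ := (Set.finite_range (fun a : I => size a)).bddAbove
  refine ⟨.seq readInput (.seq P (writeOutput l)),
    q.comp (.X * .C (C + 1) + 1), fun x => ?_⟩
  have h := (runs_readInput (i := x) (o := ([] : List O))).seq
    ((by simpa using hP x [] [] [] : Runs P _ (stk [] [] (word (f x).reverse) [] [] []) _).seq
      (runs_writeOutput hl (f x).reverse))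
  rw [List.reverse_reverse, List.append_nil, stk_eq_update_inp, stk_eq_update_out] at h
  refine h.mono ?_
  have h₁ := hq x
  have h₂ : size x ≤ x.length * (C + 1) + 1 := size_list_le fun a _ => hC ⟨a, rfl⟩
  have h₃ := eval_mono q h₂
  have h₄ := Nat.mul_le_mul_right (3 * l.length + 1) (length_le_size (f x))
  simp only [List.length_reverse, Polynomial.eval_comp, Polynomial.eval_add, Polynomial.eval_mul,
    Polynomial.eval_X, Polynomial.eval_C, Polynomial.eval_one] at h₁ ⊢
  omega

/-- Functions computed by stack programs are computable in polynomial time. -/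
theorem PT.polyTime {I O : Type} [Enc I] [Enc O] [Finite I] [Finite O] {f : List I → List O}
    (hf : PT f) {l : List O} (hl : ∀ a : O, ∃ k, l[k]? = some a ∧ enc a = encNat k) :
    PolyTime f := by
  obtain ⟨P, p, hP⟩ := hf.exists_prog hl
  refine ⟨{
    tm := P.toTM .inp .out
    inputAlphabet := Equiv.refl I
    outputAlphabet := Equiv.refl O
    time := p + 1
    outputsFun := fun x => Classical.choice ?_ }⟩
  exact (hP x).evalsToInTime (fun _ _ _ => rfl) (List.map_id x) (List.map_id (f x)) (by
    rw [Polynomial.eval_add, Polynomial.eval_one]; exact le_rfl)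

/-- Functions computed by stack programs are computable in polynomial time with any oracle. -/
theorem PT.polyTimeWithOracle {I O : Type} [Enc I] [Enc O] [Finite I] [Finite O]
    {f : List I → List O} (hf : PT f) {l : List O}
    (hl : ∀ a : O, ∃ k, l[k]? = some a ∧ enc a = encNat k) (L : Language Bool) :
    PolyTimeWithOracle L f := by
  obtain ⟨P, p, hP⟩ := hf.exists_prog hl
  let M : OracleTM I O :=
    { tm := P.toTM .inp .out
      inputAlphabet := Equiv.refl I
      outputAlphabet := Equiv.refl O
      queryStack := .main
      queryAlphabet := Equiv.refl Bool
      query := fun _ => none }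
  refine ⟨M, p + 1, fun x => ?_⟩
  exact (hP x).evalsToInTime (fun _ _ _ => rfl) (List.map_id x) (List.map_id (f x))
    (by rw [Polynomial.eval_add, Polynomial.eval_one])

/-- A concrete oracle for the second reduction, which asks no oracle questions. The verifier erases
its input and rejects. -/
theorem inNP_bot : InNP ⊥ := by
  let P : Prog (Sym (Bool ⊕ Bool) Bool) :=
    .seq (.loop .inp (fun _ => true) fun _ => .skip) (.push .out false)
  have hP : ∀ x : List (Bool ⊕ Bool), P.Runs (Function.update (fun _ => []) .inp x)
      (Function.update (fun _ => []) .out [false]) (2 * x.length + 1 + 1) := by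
    intro x
    suffices h : P.Runs (stk x [] [] [] [] []) (stk [] [false] [] [] [] []) (2 * x.length + 1 + 1) by
      rwa [stk_eq_update_inp, stk_eq_update_out] at h
    refine Prog.Runs.seq (T := stk [] [] [] [] [] []) ?_
      ((Prog.Runs.push (Γ := Sym (Bool ⊕ Bool) Bool) Stk.out false _).of_eq
        (update_stk_out ..) le_rfl)
    induction x with
    | nil => exact Prog.Runs.loop_nil rfl
    | cons a x ih =>
      exact (Prog.Runs.loop_step (k := Stk.inp) (c := fun _ => true)
        (S := stk (a :: x) [] [] [] [] []) (b := a) (l := x) rfl rfl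
        (by rw [update_stk_inp]; exact Prog.Runs.skip _) ih).of_eq rfl (by simp; omega)
  refine ⟨fun _ => false, 0, ⟨{
    tm := P.toTM .inp .out
    inputAlphabet := Equiv.refl (Bool ⊕ Bool)
    outputAlphabet := Equiv.refl Bool
    time := .C 2 * .X + .C 3
    outputsFun := fun x => Classical.choice ?_ }⟩, fun x => ?_⟩
  · exact (hP ((encodingProd (encodingList Bool) (encodingList Bool)).encode x)).evalsToInTime
      (fun _ _ _ => rfl) (List.map_id _) (List.map_id [false]) (by
        simp only [Polynomial.eval_add, Polynomial.eval_mul, Polynomial.eval_C, Polynomial.eval_X]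
        exact le_rfl)
  · simp only [Bool.false_eq_true, and_false, exists_false, iff_false]
    exact Set.notMem_empty x

end RegReal

namespace RegReal

/-! ### A union-free family of codes -/

/-- The literals of a word: `3 i + b` for a bit `b` at the position `i`, and an end marker. -/
def lits (x : List Bool) : List ℕ :=
  let s := x.foldl (fun s b => s ++ [3 * s.length + (bif b then 1 else 0)]) []
  s ++ [3 * s.length + 2]

theorem length_foldl_lits (x : List Bool) :
    (x.foldl (fun (s : List ℕ) b => s ++ [3 * s.length + (bif b then 1 else 0)]) []).length =
      x.length := by
  induction x using List.reverseRecOn with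
  | nil => rfl
  | append_singleton x b ih => simp [ih]

theorem mem_lits {x : List Bool} {n : ℕ} :
    n ∈ lits x ↔ (∃ i b, x[i]? = some b ∧ n = 3 * i + (bif b then 1 else 0)) ∨
      n = 3 * x.length + 2 := by
  have h : n ∈ x.foldl (fun (s : List ℕ) b => s ++ [3 * s.length + (bif b then 1 else 0)]) [] ↔
      ∃ i b, x[i]? = some b ∧ n = 3 * i + (bif b then 1 else 0) := by
    induction x using List.reverseRecOn with
    | nil => simp
    | append_singleton x b ih =>
      simp only [List.foldl_append, List.foldl_cons, List.foldl_nil, List.mem_append, ih,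
        List.mem_singleton, length_foldl_lits]
      constructor
      · rintro (⟨i, c, hi, rfl⟩ | rfl)
        · have := (List.getElem?_eq_some_iff.1 hi).1
          exact ⟨i, c, by rw [List.getElem?_append_left this, hi], rfl⟩
        · exact ⟨x.length, b, by simp, rfl⟩
      · rintro ⟨i, c, hi, rfl⟩
        rcases lt_trichotomy i x.length with h | rfl | h
        · rw [List.getElem?_append_left h] at hi
          exact Or.inl ⟨i, c, hi, rfl⟩
        · right
          simp only [List.getElem?_concat_length, Option.some.injEq] at hi
          rw [hi]
        · rw [List.getElem?_eq_none (by simp; omega)] at hi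
          simp at hi
  simp only [lits, List.mem_append, h, List.mem_singleton, length_foldl_lits]

/-- The end marker is the only literal congruent to 2 modulo 3, so it carries over and fixes the
length. Each position contributes exactly one literal, so the bits agree as well. -/
theorem eq_of_lits_subset {x y : List Bool} (h : ∀ n ∈ lits x, n ∈ lits y) : x = y := by
  have hl : x.length = y.length := by
    rcases mem_lits.1 (h _ (mem_lits.2 (Or.inr rfl))) with ⟨i, b, _, hi⟩ | hi
    · cases b <;> simp at hi <;> omega
    · omega
  refine List.ext_getElem hl fun i hi hi' => ?_
  rcases mem_lits.1 (h _ (mem_lits.2 (Or.inl ⟨i, x[i], by simp [hi], rfl⟩))) with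
    ⟨j, b, hj, e⟩ | e
  · have hij : i = j := by
      cases b <;> cases hx : x[i] <;> simp [hx] at e <;> omega
    subst hij
    rw [List.getElem?_eq_getElem hi', Option.some.injEq] at hj
    rw [hj]
    cases b <;> cases hx : x[i] <;> simp [hx] at e <;> rfl
  · cases hx : x[i] <;> simp [hx] at e <;> omega

/-! ### Squares of literal sets, and their rigidity. -/

/-- An injective pairing function. -/
def pairing (u v : ℕ) : ℕ := (u + v) * (u + v) + u

/-- The value lies between the square of `u + v` and the next square, which determines the sum and
then `u`. Being polynomial, this pairing is harmless for numbers in unary. -/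
theorem pairing_inj {u v u' v' : ℕ} (h : pairing u v = pairing u' v') : u = u' ∧ v = v' := by
  unfold pairing at h
  have hs : u + v = u' + v' := by
    rcases lt_trichotomy (u + v) (u' + v') with hlt | heq | hlt
    · have := Nat.mul_le_mul hlt hlt
      simp only [Nat.succ_eq_add_one] at this
      nlinarith
    · exact heq
    · have := Nat.mul_le_mul hlt hlt
      simp only [Nat.succ_eq_add_one] at this
      nlinarith
  rw [hs] at h
  omega

/-- The list of all pairs of literals of a word. -/
def codeList (x : List Bool) : List ℕ :=
  (lits x).flatMap fun u => (lits x).map fun v => pairing u v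

/-- The set of all pairs of literals of a word. -/
def codeSet (x : List Bool) : Finset ℕ := (codeList x).toFinset

/-- The sets that represent words. -/
def IsCode (S : Finset ℕ) : Prop := ∃ x, S = codeSet x

theorem mem_codeList {x : List Bool} {n : ℕ} :
    n ∈ codeList x ↔ ∃ u ∈ lits x, ∃ v ∈ lits x, pairing u v = n := by
  simp [codeList]

theorem pairing_mem_codeSet {x : List Bool} {u v : ℕ} :
    pairing u v ∈ codeSet x ↔ u ∈ lits x ∧ v ∈ lits x := by
  rw [codeSet, List.mem_toFinset, mem_codeList]
  constructor
  · rintro ⟨u', hu, v', hv, h⟩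
    obtain ⟨rfl, rfl⟩ := pairing_inj h
    exact ⟨hu, hv⟩
  · rintro ⟨hu, hv⟩
    exact ⟨u, hu, v, hv, rfl⟩

/-- The reason for taking pairs: one literal witnesses the difference from `y`, another the
difference from `z`, and their pair witnesses both at once. -/
theorem eq_or_eq_of_codeSet_subset {x y z : List Bool} (h : codeSet x ⊆ codeSet y ∪ codeSet z) :
    x = y ∨ x = z := by
  by_contra! hne
  have hy : ∃ u ∈ lits x, u ∉ lits y := by
    by_contra! h'
    exact hne.1 (eq_of_lits_subset h')
  have hz : ∃ v ∈ lits x, v ∉ lits z := by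
    by_contra! h'
    exact hne.2 (eq_of_lits_subset h')
  obtain ⟨u, hu, huy⟩ := hy
  obtain ⟨v, hv, hvz⟩ := hz
  have := h (pairing_mem_codeSet.2 ⟨hu, hv⟩)
  simp only [Finset.mem_union, pairing_mem_codeSet] at this
  tauto

theorem codeSet_injective : Function.Injective codeSet := fun x y h => by
  rcases eq_or_eq_of_codeSet_subset (x := x) (y := y) (z := y) (by rw [h]; simp) with h | h <;>
    exact h

/-- The codes form a union-free family. -/
theorem IsCode.union_free {S T S' T' : Finset ℕ} (hS : IsCode S) (hT : IsCode T) (hS' : IsCode S')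
    (hT' : IsCode T') (h : S ∪ T = S' ∪ T') : S = S' ∧ T = T' ∨ S = T' ∧ T = S' := by
  obtain ⟨x, rfl⟩ := hS
  obtain ⟨y, rfl⟩ := hT
  obtain ⟨z, rfl⟩ := hS'
  obtain ⟨w, rfl⟩ := hT'
  have hx := eq_or_eq_of_codeSet_subset (h ▸ Finset.subset_union_left : codeSet x ⊆ _)
  have hy := eq_or_eq_of_codeSet_subset (h ▸ Finset.subset_union_right : codeSet y ⊆ _)
  have hz := eq_or_eq_of_codeSet_subset
    (by rw [h]; exact Finset.subset_union_left : codeSet z ⊆ codeSet x ∪ codeSet y)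
  have hw := eq_or_eq_of_codeSet_subset
    (by rw [h]; exact Finset.subset_union_right : codeSet w ⊆ codeSet x ∪ codeSet y)
  simp only [codeSet_injective.eq_iff]
  grind

/-- Two codes cannot differ by the exchange of a single element. -/
theorem eq_of_isCode_insert {S : Finset ℕ} {a b : ℕ} (ha : a ∉ S)
    (hSa : IsCode (insert a S)) (hSb : IsCode (insert b S)) : a = b := by
  obtain ⟨x, hx⟩ := hSa
  obtain ⟨y, hy⟩ := hSb
  -- At most the element `a` of the first code is missing from the second. But a literal `u` absent
  -- from `y` makes all pairs of `u` with literals of `x` missing, so `x` has no literal besides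
  -- `u`.
  have key : ∀ {x y : List Bool} {a b : ℕ}, insert a S = codeSet x → insert b S = codeSet y →
      x ≠ y → ∀ v ∈ lits x, ∀ u ∈ lits x, u ∉ lits y → v = u := by
    intro x y a b hx hy hxy v hv u hu huy
    have h₁ : pairing u v ∈ insert a S := hx ▸ pairing_mem_codeSet.2 ⟨hu, hv⟩
    have h₂ : pairing u u ∈ insert a S := hx ▸ pairing_mem_codeSet.2 ⟨hu, hu⟩
    have h₃ : pairing u v ∉ insert b S := by
      rw [hy, pairing_mem_codeSet]
      tauto
    have h₄ : pairing u u ∉ insert b S := by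
      rw [hy, pairing_mem_codeSet]
      tauto
    simp only [Finset.mem_insert, not_or] at h₁ h₂ h₃ h₄
    have := (h₁.resolve_right h₃.2).trans (h₂.resolve_right h₄.2).symm
    exact (pairing_inj this).2
  -- A nonempty word has at least two literals, a first bit and the end marker. By symmetry both
  -- words would be empty, hence equal.
  have one : ∀ {x y : List Bool} {a b : ℕ}, insert a S = codeSet x → insert b S = codeSet y →
      x ≠ y → x = [] := by
    intro x y a b hx hy hxy
    have hu : ∃ u ∈ lits x, u ∉ lits y := by
      by_contra! h'
      exact hxy (eq_of_lits_subset h')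
    obtain ⟨u, hu, huy⟩ := hu
    cases x with
    | nil => rfl
    | cons c x =>
      have e₁ := key hx hy hxy _ (mem_lits.2 (Or.inr rfl)) u hu huy
      have e₂ := key hx hy hxy _ (mem_lits.2 (Or.inl ⟨0, c, by simp, rfl⟩)) u hu huy
      rw [← e₂] at e₁
      cases c <;> simp at e₁
  by_cases hxy : x = y
  · subst hxy
    have : a ∈ insert b S := by rw [hy, ← hx]; exact Finset.mem_insert_self _ _
    simp only [Finset.mem_insert] at this
    tauto
  · exact absurd ((one hx hy hxy).trans (one hy hx (Ne.symm hxy)).symm) hxy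

/-! ### Decoding lists of numbers. -/

/-- The word represented by a list, if there is any. -/
def decodeBits (l : List ℕ) : List Bool :=
  (List.range l.length).flatMap fun i =>
    if pairing (3 * i) (3 * i) ∈ l then [false]
    else if pairing (3 * i + 1) (3 * i + 1) ∈ l then [true] else []

theorem flatMap_getElem? {x : List Bool} {n : ℕ} (h : x.length ≤ n) :
    (List.range n).flatMap (fun i => x[i]?.toList) = x := by
  induction n generalizing x with
  | zero => simp at h; subst h; rfl
  | succ n ih =>
    rw [List.range_succ_eq_map, List.flatMap_cons, List.flatMap_map]
    cases x with
    | nil => simp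
    | cons b x => simpa using ih (x := x) (by simpa using h)

/-- The diagonal pairs reveal the literals. The diagonal alone has at least as many elements as `x`
has bits, so searching positions below the length of `l` is enough; positions beyond `x` contribute
nothing. -/
theorem decodeBits_eq {l : List ℕ} {x : List Bool} (h : l.toFinset = codeSet x) :
    decodeBits l = x := by
  have hmem : ∀ u, pairing u u ∈ l ↔ u ∈ lits x := fun u => by
    rw [← List.mem_toFinset, h, pairing_mem_codeSet, and_self]
  have hlen : x.length ≤ l.length := by
    have h₁ : ((Finset.range x.length).image fun i => pairing (3 * i + (bif (x[i]?.getD false) then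
        1 else 0)) (3 * i + (bif (x[i]?.getD false) then 1 else 0))) ⊆ l.toFinset := by
      intro n hn
      simp only [Finset.mem_image, Finset.mem_range] at hn
      obtain ⟨i, hi, rfl⟩ := hn
      rw [List.mem_toFinset, hmem, mem_lits]
      exact Or.inl ⟨i, x[i], by simp [hi], by simp [hi]⟩
    have h₂ := (Finset.card_le_card h₁).trans (List.toFinset_card_le l)
    rw [Finset.card_image_of_injective, Finset.card_range] at h₂
    · exact h₂
    · intro i j hij
      have := (pairing_inj hij).1
      revert this
      cases x[i]?.getD false <;> cases x[j]?.getD false <;>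
        simp only [cond_true, cond_false] <;> omega
  rw [decodeBits, ← flatMap_getElem? hlen]
  refine List.flatMap_congr fun i _ => ?_
  have h₀ : pairing (3 * i) (3 * i) ∈ l ↔ x[i]? = some false := by
    rw [hmem, mem_lits]
    constructor
    · rintro (⟨j, b, hj, e⟩ | e)
      · cases b <;> simp at e
        · subst e; exact hj
        · omega
      · omega
    · exact fun hi => Or.inl ⟨i, false, hi, rfl⟩
  have h₁ : pairing (3 * i + 1) (3 * i + 1) ∈ l ↔ x[i]? = some true := by
    rw [hmem, mem_lits]
    constructor
    · rintro (⟨j, b, hj, e⟩ | e)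
      · cases b <;> simp at e
        · omega
        · subst e; exact hj
      · omega
    · exact fun hi => Or.inl ⟨i, true, hi, rfl⟩
  simp only [h₀, h₁]
  rcases x[i]? with _ | _ | _ <;> simp

/-- The word represented by a list, and `d` if the list represents no word. -/
def decodeD (d : List Bool) (l : List ℕ) : List Bool :=
  bif (l.all fun n => decide (n ∈ codeList (decodeBits l))) &&
    ((codeList (decodeBits l)).all fun n => decide (n ∈ l))
  then decodeBits l else d

theorem decodeD_of_eq (d : List Bool) {l : List ℕ} {x : List Bool} (h : l.toFinset = codeSet x) :
    decodeD d l = x := by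
  have h' : ∀ n, n ∈ l ↔ n ∈ codeList x := fun n => by
    rw [← List.mem_toFinset, h, codeSet, List.mem_toFinset]
  rw [decodeD, decodeBits_eq h, cond_eq_ite, if_pos]
  simp [h']

theorem decodeD_of_not_isCode (d : List Bool) {l : List ℕ} (h : ¬ IsCode l.toFinset) :
    decodeD d l = d := by
  rw [decodeD, cond_eq_ite, if_neg]
  intro hb
  simp only [Bool.and_eq_true, List.all_eq_true, decide_eq_true_eq] at hb
  refine h ⟨decodeBits l, ?_⟩
  ext n
  rw [codeSet, List.mem_toFinset, List.mem_toFinset]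
  exact ⟨hb.1 n, hb.2 n⟩

/-- The codes of the words from `X`, together with all sets that are not codes. -/
def family (X : Language Bool) : Set (Finset ℕ) :=
  {S | (∃ x ∈ X, S = codeSet x) ∨ ¬ IsCode S}

theorem codeSet_mem_family {X : Language Bool} {x : List Bool} : codeSet x ∈ family X ↔ x ∈ X := by
  constructor
  · rintro (⟨y, hy, h⟩ | h)
    · rwa [codeSet_injective h]
    · exact absurd ⟨x, rfl⟩ h
  · exact fun h => Or.inl ⟨x, h, rfl⟩

/-- All non-codes belong to the family, so the default must be a member of `X`. This is where
nonemptiness of `X` enters. -/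
theorem decodeD_mem_iff {X : Language Bool} {d : List Bool} (hd : d ∈ X) (l : List ℕ) :
    decodeD d l ∈ X ↔ l.toFinset ∈ family X := by
  by_cases h : IsCode l.toFinset
  · obtain ⟨x, hx⟩ := h
    rw [decodeD_of_eq d hx, hx, codeSet_mem_family]
  · rw [decodeD_of_not_isCode d h]
    exact iff_of_true hd (Or.inr h)

end RegReal

namespace RegReal

/-! ### Walks in labelled graphs -/

section Walks

variable {Λ : Type} {E : List (ℕ × Λ × ℕ)}

/-- A walk in a graph that is given by the list of its labelled edges. -/
def IsWalk (E : List (ℕ × Λ × ℕ)) : ℕ → List (ℕ × Λ × ℕ) → ℕ → Prop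
  | p, [], q => p = q
  | p, e :: w, q => e ∈ E ∧ e.1 = p ∧ IsWalk E e.2.2 w q

/-- The labels along a walk. -/
def labels (w : List (ℕ × Λ × ℕ)) : List Λ := w.map fun e => e.2.1

@[simp] theorem labels_append (w w' : List (ℕ × Λ × ℕ)) :
    labels (w ++ w') = labels w ++ labels w' := by simp [labels]

@[simp] theorem labels_cons (e : ℕ × Λ × ℕ) (w : List (ℕ × Λ × ℕ)) :
    labels (e :: w) = e.2.1 :: labels w := rfl

@[simp] theorem labels_nil : labels ([] : List (ℕ × Λ × ℕ)) = [] := rfl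

theorem isWalk_append {w w' : List (ℕ × Λ × ℕ)} {p q : ℕ} :
    IsWalk E p (w ++ w') q ↔ ∃ r, IsWalk E p w r ∧ IsWalk E r w' q := by
  induction w generalizing p with
  | nil => simp [IsWalk]
  | cons e w ih => simp [IsWalk, ih, and_assoc]

theorem IsWalk.mono {E' : List (ℕ × Λ × ℕ)} (h : E ⊆ E') {w : List (ℕ × Λ × ℕ)} {p q : ℕ}
    (hw : IsWalk E p w q) : IsWalk E' p w q := by
  induction w generalizing p with
  | nil => exact hw
  | cons e w ih => exact ⟨h hw.1, hw.2.1, ih hw.2.2⟩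

theorem IsWalk.subset {w : List (ℕ × Λ × ℕ)} {p q : ℕ} (hw : IsWalk E p w q) : w ⊆ E := by
  induction w generalizing p with
  | nil => simp
  | cons e w ih => exact List.cons_subset.2 ⟨hw.1, ih hw.2.2⟩

theorem IsWalk.of_subset {E' : List (ℕ × Λ × ℕ)} {w : List (ℕ × Λ × ℕ)} {p q : ℕ}
    (hw : IsWalk E p w q) (h : w ⊆ E') : IsWalk E' p w q := by
  induction w generalizing p with
  | nil => exact hw
  | cons e w ih =>
    rw [List.cons_subset] at h
    exact ⟨h.1, hw.2.1, ih hw.2.2 h.2⟩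

theorem exists_repetition {α : Type} {l : List α} (h : ¬ l.Nodup) :
    ∃ l₁ a l₂ l₃, l = l₁ ++ a :: (l₂ ++ a :: l₃) := by
  induction l with
  | nil => simp at h
  | cons b l ih =>
    by_cases hb : b ∈ l
    · obtain ⟨l₂, l₃, rfl⟩ := List.append_of_mem hb
      exact ⟨[], b, l₂, l₃, rfl⟩
    · obtain ⟨l₁, a, l₂, l₃, rfl⟩ := ih (by simpa [hb] using h)
      exact ⟨b :: l₁, a, l₂, l₃, rfl⟩

/-- A long walk contains a short closed walk. -/
theorem IsWalk.exists_cycle {w : List (ℕ × Λ × ℕ)} {p q : ℕ} (hw : IsWalk E p w q)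
    (hlen : E.length < w.length) :
    ∃ w₁ c w₂ r, w = w₁ ++ c ++ w₂ ∧ 1 ≤ c.length ∧ c.length ≤ E.length ∧
      IsWalk E p w₁ r ∧ IsWalk E r c r ∧ IsWalk E r w₂ q := by
  -- Pigeonhole on edges instead of vertices: some edge repeats among the first `E.length + 1`
  -- steps, and the stretch after its first up to its second occurrence is closed.
  have hd : ¬ (w.take (E.length + 1)).Nodup := by
    intro h
    have h₁ := (List.subperm_of_subset h
      (fun e he => hw.subset (List.mem_of_mem_take he))).length_le
    rw [List.length_take] at h₁
    omega
  obtain ⟨l₁, e, l₂, l₃, hl⟩ := exists_repetition hd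
  have hlen' := congrArg List.length hl
  simp only [List.length_take, List.length_append, List.length_cons] at hlen'
  have hw' : w = (l₁ ++ [e]) ++ ((l₂ ++ [e]) ++ (l₃ ++ w.drop (E.length + 1))) := by
    conv_lhs => rw [← List.take_append_drop (E.length + 1) w, hl]
    simp
  rw [hw'] at hw
  obtain ⟨r, h₁, h₂⟩ := isWalk_append.1 hw
  obtain ⟨r', h₃, h₄⟩ := isWalk_append.1 h₂
  have hr : ∀ {a b : ℕ} {l : List (ℕ × Λ × ℕ)}, IsWalk E a (l ++ [e]) b → b = e.2.2 := by
    intro a b l h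
    obtain ⟨_, _, h⟩ := isWalk_append.1 h
    exact h.2.2.symm
  obtain rfl := hr h₁
  obtain rfl := hr h₃
  exact ⟨_, _, _, _, by rw [List.append_assoc]; exact hw', by simp, by simp; omega, h₁, h₃, h₄⟩

theorem IsWalk.exists_short {w : List (ℕ × Λ × ℕ)} {p q : ℕ} (hw : IsWalk E p w q) :
    ∃ w', IsWalk E p w' q ∧ w'.length ≤ E.length := by
  induction h : w.length using Nat.strong_induction_on generalizing w with
  | _ n ih =>
    by_cases hlen : w.length ≤ E.length
    · exact ⟨w, hw, hlen⟩
    · obtain ⟨w₁, c, w₂, r, rfl, hc, _, h₁, _, h₂⟩ := hw.exists_cycle (by omega)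
      refine ih (w₁ ++ w₂).length ?_ (isWalk_append.2 ⟨r, h₁, h₂⟩) rfl
      simp only [List.length_append] at h ⊢
      omega

end Walks

/-! ### Finding walks -/

/-- The first value stored under a key in a table, as a list of length at most one. -/
def lookupFirst (t : List (ℕ × List ℕ)) (p : ℕ) : List (List ℕ) :=
  bif (t.filter fun r => decide (r.1 = p)).isEmpty then []
  else [((t.filter fun r => decide (r.1 = p)).headI).2]

theorem mem_of_mem_lookupFirst {t : List (ℕ × List ℕ)} {p : ℕ} {w : List ℕ}
    (h : w ∈ lookupFirst t p) : (p, w) ∈ t := by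
  unfold lookupFirst at h
  cases hf : t.filter fun r => decide (r.1 = p) with
  | nil => simp [hf] at h
  | cons r l =>
    have hr : r ∈ t.filter fun r => decide (r.1 = p) := by simp [hf]
    simp only [List.mem_filter, decide_eq_true_eq] at hr
    simp only [hf, List.isEmpty_cons, cond_false, List.headI_cons, List.mem_singleton] at h
    rw [h, ← hr.2]
    exact hr.1

theorem exists_mem_lookupFirst {t : List (ℕ × List ℕ)} {p : ℕ} {w : List ℕ}
    (h : (p, w) ∈ t) : ∃ w', w' ∈ lookupFirst t p := by
  unfold lookupFirst
  cases hf : t.filter fun r => decide (r.1 = p) with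
  | nil =>
    have : (p, w) ∈ t.filter fun r => decide (r.1 = p) := by simp [h]
    simp [hf] at this
  | cons r l => simp

theorem lookupFirst_cons_self (t : List (ℕ × List ℕ)) (p : ℕ) (w : List ℕ) :
    lookupFirst ((p, w) :: t) p = [w] := by
  simp [lookupFirst]

theorem length_lookupFirst_le (t : List (ℕ × List ℕ)) (p : ℕ) : (lookupFirst t p).length ≤ 1 := by
  unfold lookupFirst
  cases (t.filter fun r => decide (r.1 = p)).isEmpty <;> simp

/-- One round of the search: extend the walks found so far by all edges. -/
def extendTable (E : List (ℕ × ℕ × ℕ)) (s : ℕ) (t : List (ℕ × List ℕ)) : List (ℕ × List ℕ) :=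
  (s, []) :: E.flatMap fun e => (lookupFirst t e.1).map fun w => (e.2.2, w ++ [e.2.1])

/-- The table of labels of walks from `s`, after a number of rounds. -/
def walkTable (E : List (ℕ × ℕ × ℕ)) (s : ℕ) (n : ℕ) : List (ℕ × List ℕ) :=
  (List.replicate n ()).foldl (fun t _ => extendTable E s t) [(s, [])]

theorem walkTable_succ (E : List (ℕ × ℕ × ℕ)) (s n : ℕ) :
    walkTable E s (n + 1) = extendTable E s (walkTable E s n) := by
  simp [walkTable, List.replicate_succ']

theorem walkTable_eq_cons (E : List (ℕ × ℕ × ℕ)) (s n : ℕ) :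
    ∃ t, walkTable E s n = (s, []) :: t := by
  cases n with
  | zero => exact ⟨[], rfl⟩
  | succ n => exact ⟨_, walkTable_succ E s n⟩

/-- The labels of a walk from `s` to `t`, if there is any. -/
def route (E : List (ℕ × ℕ × ℕ)) (s t : ℕ) : List (List ℕ) :=
  lookupFirst (walkTable E s E.length) t

section Route

variable {E : List (ℕ × ℕ × ℕ)} {s t : ℕ}

/-- Every round puts the empty walk first in the table, so it is what the lookup at `s` returns.
Options can therefore begin or end with a prescribed edge. -/
theorem nil_mem_route (E : List (ℕ × ℕ × ℕ)) (s : ℕ) : [] ∈ route E s s := by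
  obtain ⟨t, ht⟩ := walkTable_eq_cons E s E.length
  rw [route, ht, lookupFirst_cons_self]
  simp

theorem exists_walk_of_mem_route {l : List ℕ} (h : l ∈ route E s t) :
    ∃ w, IsWalk E s w t ∧ labels w = l := by
  have key : ∀ n t l, (t, l) ∈ walkTable E s n → ∃ w, IsWalk E s w t ∧ labels w = l := by
    intro n
    induction n with
    | zero =>
      intro t l h
      simp only [walkTable, List.replicate_zero, List.foldl_nil, List.mem_singleton,
        Prod.mk.injEq] at h
      exact ⟨[], h.1.symm, h.2.symm⟩
    | succ n ih =>
      intro t l h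
      rw [walkTable_succ, extendTable, List.mem_cons] at h
      rcases h with h | h
      · simp only [Prod.mk.injEq] at h
        exact ⟨[], h.1.symm, h.2.symm⟩
      · simp only [List.mem_flatMap, List.mem_map, Prod.mk.injEq] at h
        obtain ⟨e, he, l', hl', rfl, rfl⟩ := h
        obtain ⟨w, hw, rfl⟩ := ih _ _ (mem_of_mem_lookupFirst hl')
        exact ⟨w ++ [e], isWalk_append.2 ⟨_, hw, he, rfl, rfl⟩, by simp⟩
  exact key _ _ _ (mem_of_mem_lookupFirst h)

/-- After `n` rounds every endpoint of a walk of length at most `n` has an entry, and cutting out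
cycles shows that `E.length` rounds suffice. Only reachability is preserved: the stored walk may
have other labels than `w`. -/
theorem exists_mem_route {w : List (ℕ × ℕ × ℕ)} (h : IsWalk E s w t) : ∃ l, l ∈ route E s t := by
  have key : ∀ n t w, IsWalk E s w t → w.length ≤ n → ∃ l, (t, l) ∈ walkTable E s n := by
    intro n
    induction n with
    | zero =>
      intro t w hw hn
      simp only [Nat.le_zero, List.length_eq_zero_iff] at hn
      subst hn
      obtain rfl : s = t := hw
      exact ⟨[], by simp [walkTable]⟩
    | succ n ih =>
      intro t w hw hn
      rw [walkTable_succ]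
      rcases List.eq_nil_or_concat w with rfl | ⟨w', e, rfl⟩
      · obtain rfl : s = t := hw
        exact ⟨[], List.mem_cons_self⟩
      · obtain ⟨r, h₁, he, rfl, rfl⟩ := isWalk_append.1 (by simpa using hw)
        obtain ⟨l, hl⟩ := ih _ _ h₁ (by simpa using hn)
        obtain ⟨l', hl'⟩ := exists_mem_lookupFirst hl
        refine ⟨l' ++ [e.2.1], List.mem_cons_of_mem _ ?_⟩
        simp only [List.mem_flatMap, List.mem_map]
        exact ⟨e, he, l', hl', rfl⟩
  obtain ⟨w', hw', hlen⟩ := h.exists_short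
  obtain ⟨l, hl⟩ := key _ _ _ hw' hlen
  exact exists_mem_lookupFirst hl

end Route

/-! ### Polynomially many representative walks. -/

/-- Labels of walks from `s` to `t`: for every forbidden label `z ≤ B` a walk that avoids `z`, and
for every edge without the label `z` a walk through this edge that avoids `z`. -/
def options (E : List (ℕ × ℕ × ℕ)) (B s t : ℕ) : List (List ℕ) :=
  (List.range (B + 1)).flatMap fun z =>
    route (E.filter fun e => !decide (e.2.1 = z)) s t ++
      (E.filter fun e => !decide (e.2.1 = z)).flatMap fun e =>
        (route (E.filter fun e => !decide (e.2.1 = z)) s e.1).flatMap fun l =>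
          (route (E.filter fun e => !decide (e.2.1 = z)) e.2.2 t).map fun l' => l ++ e.2.1 :: l'

section Options

variable {E : List (ℕ × ℕ × ℕ)} {B s t : ℕ}

theorem exists_walk_of_mem_options {l : List ℕ} (h : l ∈ options E B s t) :
    ∃ w, IsWalk E s w t ∧ labels w = l := by
  simp only [options, List.mem_flatMap, List.mem_append, List.mem_map] at h
  obtain ⟨z, -, h⟩ := h
  have hsub : (E.filter fun e => !decide (e.2.1 = z)) ⊆ E := List.filter_subset_self _
  rcases h with h | ⟨e, he, l₁, h₁, l₂, h₂, rfl⟩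
  · obtain ⟨w, hw, rfl⟩ := exists_walk_of_mem_route h
    exact ⟨w, hw.mono hsub, rfl⟩
  · obtain ⟨w₁, hw₁, rfl⟩ := exists_walk_of_mem_route h₁
    obtain ⟨w₂, hw₂, rfl⟩ := exists_walk_of_mem_route h₂
    exact ⟨w₁ ++ e :: w₂, isWalk_append.2 ⟨_, hw₁.mono hsub, hsub he, rfl, hw₂.mono hsub⟩, by simp⟩

theorem IsWalk.filter {w : List (ℕ × ℕ × ℕ)} {z : ℕ} (hw : IsWalk E s w t) (hz : z ∉ labels w) :
    IsWalk (E.filter fun e => !decide (e.2.1 = z)) s w t := by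
  refine hw.of_subset fun e he => ?_
  simp only [List.mem_filter, Bool.not_eq_true', decide_eq_false_iff_not]
  refine ⟨hw.subset he, fun h => hz ?_⟩
  rw [← h]
  exact List.mem_map_of_mem he

theorem notMem_labels_of_filter {w : List (ℕ × ℕ × ℕ)} {z : ℕ}
    (hw : IsWalk (E.filter fun e => !decide (e.2.1 = z)) s w t) : z ∉ labels w := by
  intro hz
  obtain ⟨e, he, h⟩ := List.mem_map.1 hz
  have := hw.subset he
  simp [h] at this

theorem nil_mem_options : [] ∈ options E B s s := by
  simp only [options, List.mem_flatMap, List.mem_append, List.mem_range]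
  exact ⟨B, by omega, Or.inl (nil_mem_route _ _)⟩

variable (hE : ∀ e ∈ E, e.2.1 < B)
include hE

theorem notMem_labels_of_le {w : List (ℕ × ℕ × ℕ)} {z : ℕ} (hw : IsWalk E s w t) (hz : B ≤ z) :
    z ∉ labels w := by
  intro h
  obtain ⟨e, he, rfl⟩ := List.mem_map.1 h
  have := hE e (hw.subset he)
  omega

/-- Among the options there are walks that start with a given edge, avoid a given label, and go on
to the end of a given walk. -/
theorem exists_cons_mem_options {e : ℕ × ℕ × ℕ} {w : List (ℕ × ℕ × ℕ)} {z : ℕ} (he : e ∈ E)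
    (hw : IsWalk E e.2.2 w t) (hez : z ≠ e.2.1) (hz : z ∉ labels w) :
    ∃ w', IsWalk E e.2.2 w' t ∧ z ∉ labels w' ∧ e.2.1 :: labels w' ∈ options E B e.1 t := by
  have key : ∀ z, z ≤ B → z ≠ e.2.1 → z ∉ labels w → ∃ w', IsWalk E e.2.2 w' t ∧ z ∉ labels w' ∧
      e.2.1 :: labels w' ∈ options E B e.1 t := by
    intro z hzB hez hz
    obtain ⟨l, hl⟩ := exists_mem_route (hw.filter hz)
    obtain ⟨w', hw', rfl⟩ := exists_walk_of_mem_route hl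
    refine ⟨w', hw'.mono (List.filter_subset_self _), notMem_labels_of_filter hw', ?_⟩
    simp only [options, List.mem_flatMap, List.mem_append, List.mem_map, List.mem_range]
    exact ⟨z, by omega, Or.inr ⟨e, by simpa using ⟨he, hez.symm⟩, [], nil_mem_route _ _, _, hl, rfl⟩⟩
  -- All labels are below `B`, so forbidding `B` forbids nothing. This choice serves for every `z`
  -- beyond the range.
  rcases le_or_gt z B with h | h
  · exact key z h hez hz
  · obtain ⟨w', hw', -, hm⟩ := key B le_rfl (hE e he).ne' (notMem_labels_of_le hE hw le_rfl)
    exact ⟨w', hw', notMem_labels_of_le hE hw' h.le, hm⟩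

theorem exists_concat_mem_options {e : ℕ × ℕ × ℕ} {w : List (ℕ × ℕ × ℕ)} (he : e ∈ E)
    (hw : IsWalk E s w e.1) :
    ∃ w', IsWalk E s w' e.1 ∧ labels w' ++ [e.2.1] ∈ options E B s e.2.2 := by
  obtain ⟨l, hl⟩ := exists_mem_route (hw.filter (notMem_labels_of_le hE hw le_rfl))
  obtain ⟨w', hw', rfl⟩ := exists_walk_of_mem_route hl
  refine ⟨w', hw'.mono (List.filter_subset_self _), ?_⟩
  simp only [options, List.mem_flatMap, List.mem_append, List.mem_map, List.mem_range]
  exact ⟨B, by omega, Or.inr ⟨e, by simpa using ⟨he, (hE e he).ne⟩, _, hl, [],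
    nil_mem_route _ _, rfl⟩⟩

/-- One half of the approximation of arbitrary walks by options: the walk is cut at an edge labelled
`y`, and the pieces around this edge are replaced by computed routes. -/
theorem exists_mem_options_mem {w : List (ℕ × ℕ × ℕ)} {y : ℕ} (hw : IsWalk E s w t)
    (hy : y ∈ labels w) : ∃ l ∈ options E B s t, y ∈ l := by
  obtain ⟨e, he, rfl⟩ := List.mem_map.1 hy
  obtain ⟨w₁, w₂, rfl⟩ := List.append_of_mem he
  obtain ⟨r, h₁, he', rfl, h₂⟩ := isWalk_append.1 hw
  obtain ⟨l₁, hl₁⟩ := exists_mem_route (h₁.filter (notMem_labels_of_le hE h₁ le_rfl))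
  obtain ⟨l₂, hl₂⟩ := exists_mem_route (h₂.filter (notMem_labels_of_le hE h₂ le_rfl))
  refine ⟨l₁ ++ e.2.1 :: l₂, ?_, by simp⟩
  simp only [options, List.mem_flatMap, List.mem_append, List.mem_map, List.mem_range]
  exact ⟨B, by omega, Or.inr ⟨e, by simpa using ⟨he', (hE e he').ne⟩, _, hl₁, _, hl₂, rfl⟩⟩

/-- The other half of the approximation: the walk survives in the graph without the label `z`, so
the search there succeeds. -/
theorem exists_mem_options_notMem {w : List (ℕ × ℕ × ℕ)} {z : ℕ} (hw : IsWalk E s w t)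
    (hz : z ∉ labels w) : ∃ l ∈ options E B s t, z ∉ l := by
  have key : ∀ z, z ≤ B → z ∉ labels w → ∃ w', IsWalk E s w' t ∧ z ∉ labels w' ∧
      labels w' ∈ options E B s t := by
    intro z hzB hz
    obtain ⟨l, hl⟩ := exists_mem_route (hw.filter hz)
    obtain ⟨w', hw', rfl⟩ := exists_walk_of_mem_route hl
    refine ⟨w', hw'.mono (List.filter_subset_self _), notMem_labels_of_filter hw', ?_⟩
    simp only [options, List.mem_flatMap, List.mem_append, List.mem_range]
    exact ⟨z, by omega, Or.inl hl⟩
  rcases le_or_gt z B with h | h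
  · obtain ⟨w', -, hz', hm⟩ := key z h hz
    exact ⟨_, hm, hz'⟩
  · obtain ⟨w', hw', -, hm⟩ := key B le_rfl (notMem_labels_of_le hE hw le_rfl)
    exact ⟨_, hm, notMem_labels_of_le hE hw' h.le⟩

end Options

/-- Labels of polynomially many walks from `s` to the set `F`. -/
def candidates (E : List (ℕ × ℕ × ℕ)) (B : ℕ) (V : List ℕ) (s : ℕ) (F : List ℕ) : List (List ℕ) :=
  V.flatMap fun q => (options E B s q).flatMap fun l =>
    F.flatMap fun f => (options E B q f).map fun l' => l ++ l'

theorem mem_candidates {E : List (ℕ × ℕ × ℕ)} {B : ℕ} {V : List ℕ} {s : ℕ} {F : List ℕ}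
    {l : List ℕ} : l ∈ candidates E B V s F ↔ ∃ q ∈ V, ∃ l₁ ∈ options E B s q,
      ∃ f ∈ F, ∃ l₂ ∈ options E B q f, l₁ ++ l₂ = l := by
  simp [candidates]

theorem exists_walk_of_mem_candidates {E : List (ℕ × ℕ × ℕ)} {B : ℕ} {V : List ℕ} {s : ℕ}
    {F : List ℕ} {l : List ℕ} (h : l ∈ candidates E B V s F) :
    ∃ f ∈ F, ∃ w, IsWalk E s w f ∧ labels w = l := by
  obtain ⟨q, -, l₁, h₁, f, hf, l₂, h₂, rfl⟩ := mem_candidates.1 h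
  obtain ⟨w₁, hw₁, rfl⟩ := exists_walk_of_mem_options h₁
  obtain ⟨w₂, hw₂, rfl⟩ := exists_walk_of_mem_options h₂
  exact ⟨f, hf, w₁ ++ w₂, isWalk_append.2 ⟨q, hw₁, hw₂⟩, by simp⟩

/-- If a matrix of sets has only codes as entries and the entries are unions of a set that depends on
the row and a set that depends on the column, then it is constant on all columns or on all rows. -/
theorem constant_of_forall_isCode {P T : Set (Finset ℕ)}
    (h : ∀ a ∈ P, ∀ b ∈ T, IsCode (a ∪ b)) :
    (∀ b ∈ T, ∀ a ∈ P, ∀ a' ∈ P, a ∪ b = a' ∪ b) ∨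
      ∀ a ∈ P, ∀ b ∈ T, ∀ b' ∈ T, a ∪ b = a ∪ b' := by
  -- In a two by two submatrix both diagonals have the same union, so union-freeness identifies them
  -- as unordered pairs. Either both rows or both columns are constant.
  have two : ∀ a ∈ P, ∀ a' ∈ P, ∀ b ∈ T, ∀ b' ∈ T,
      (a ∪ b = a ∪ b' ∧ a' ∪ b' = a' ∪ b) ∨ (a ∪ b = a' ∪ b ∧ a' ∪ b' = a ∪ b') := by
    intro a ha a' ha' b hb b' hb'
    refine (h a ha b hb).union_free (h a' ha' b' hb') (h a ha b' hb') (h a' ha' b hb) ?_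
    ext x
    simp only [Finset.mem_union]
    tauto
  by_contra! hne
  -- Row `c` differs at `d` and `d'`, so column `d` takes the same value in the rows `a`, `a'` and
  -- `c`. The submatrix with rows `a`, `a'` and columns `d`, `b` then makes column `b` agree in the
  -- rows `a` and `a'`, a contradiction.
  obtain ⟨⟨b, hb, a, ha, a', ha', h₁⟩, c, hc, d, hd, d', hd', h₂⟩ := hne
  have e₁ := two c hc a ha d hd d' hd'
  have e₂ := two c hc a' ha' d hd d' hd'
  have e₃ := two c hc a ha d hd b hb
  have e₄ := two c hc a' ha' d hd b hb
  have e₅ := two a ha a' ha' d hd b hb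
  grind

/-! ### Completeness of the candidates when all of them are codes. -/

section Completeness

variable {E : List (ℕ × ℕ × ℕ)} {B : ℕ} {V : List ℕ} {s : ℕ} {F : List ℕ}

/-- If all candidates are codes, then every walk from `s` to `F` has the same labels as a
candidate. -/
theorem exists_candidate (hE : ∀ e ∈ E, e.2.1 < B) (hs : s ∈ V) (hV : ∀ e ∈ E, e.2.2 ∈ V)
    (hcode : ∀ l ∈ candidates E B V s F, IsCode l.toFinset) {w : List (ℕ × ℕ × ℕ)} {f : ℕ}
    (hf : f ∈ F) (hw : IsWalk E s w f) :
    ∃ l ∈ candidates E B V s F, l.toFinset = (labels w).toFinset := by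
  classical
  let T : ℕ → Set (List ℕ) := fun q => {l | ∃ f ∈ F, l ∈ options E B q f}
  -- `PI` stands for independence of the prefix and `SI` for independence of the suffix. By the
  -- matrix lemma every state has at least one of the two.
  let PI : ℕ → Prop := fun q => ∀ b ∈ T q, ∀ a ∈ options E B s q, ∀ a' ∈ options E B s q,
    (a ++ b).toFinset = (a' ++ b).toFinset
  let SI : ℕ → Prop := fun q => ∀ a ∈ options E B s q, ∀ b ∈ T q, ∀ b' ∈ T q,
    (a ++ b).toFinset = (a ++ b').toFinset
  have hPS : ∀ q ∈ V, PI q ∨ SI q := by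
    intro q hq
    have h := constant_of_forall_isCode (P := List.toFinset '' {a | a ∈ options E B s q})
      (T := List.toFinset '' T q) (by
        rintro _ ⟨a, ha, rfl⟩ _ ⟨b, ⟨f, hf, hb⟩, rfl⟩
        rw [← List.toFinset_append]
        exact hcode _ (mem_candidates.2 ⟨q, hq, a, ha, f, hf, b, hb, rfl⟩))
    simp only [Set.forall_mem_image, ← List.toFinset_append] at h
    exact h
  -- the union with an option does not depend on the prefix, for all prefixes
  have prefix_indep : ∀ {q}, PI q → ∀ {b}, b ∈ T q → ∀ {a}, a ∈ options E B s q → ∀ {u},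
      IsWalk E s u q → (labels u ++ b).toFinset = (a ++ b).toFinset := by
    intro q hq b hb a ha u hu
    ext x
    simp only [List.mem_toFinset]
    constructor
    · intro hx
      rcases List.mem_append.1 hx with hx | hx
      · obtain ⟨a', ha', hxa⟩ := exists_mem_options_mem hE hu hx
        rw [← List.mem_toFinset, hq b hb a ha a' ha']
        simp [hxa]
      · simp [hx]
    · intro hx
      by_contra hxu
      simp only [List.mem_append, not_or] at hxu
      obtain ⟨a', ha', hxa⟩ := exists_mem_options_notMem hE hu hxu.1
      rw [← List.mem_toFinset, hq b hb a ha a' ha'] at hx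
      simp [hxa, hxu.2] at hx
  have suffix_indep : ∀ {q}, SI q → ∀ {a}, a ∈ options E B s q → ∀ {b}, b ∈ T q → ∀ {u f},
      f ∈ F → IsWalk E q u f → (a ++ labels u).toFinset = (a ++ b).toFinset := by
    intro q hq a ha b hb u f hf hu
    ext x
    simp only [List.mem_toFinset]
    constructor
    · intro hx
      rcases List.mem_append.1 hx with hx | hx
      · simp [hx]
      · obtain ⟨b', hb', hxb⟩ := exists_mem_options_mem hE hu hx
        rw [← List.mem_toFinset, hq a ha b hb b' ⟨f, hf, hb'⟩]
        simp [hxb]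
    · intro hx
      by_contra hxu
      simp only [List.mem_append, not_or] at hxu
      obtain ⟨b', hb', hxb⟩ := exists_mem_options_notMem hE hu hxu.2
      rw [← List.mem_toFinset, hq a ha b hb b' ⟨f, hf, hb'⟩] at hx
      simp [hxb, hxu.1] at hx
  have option_of_walk : ∀ {a b : ℕ} {u : List (ℕ × ℕ × ℕ)}, IsWalk E a u b →
      ∃ l, l ∈ options E B a b := by
    intro a b u hu
    obtain ⟨l, hl, -⟩ := exists_mem_options_notMem hE hu (notMem_labels_of_le hE hu le_rfl)
    exact ⟨l, hl⟩
  have hmem : ∀ {p u q}, IsWalk E p u q → p ∈ V → q ∈ V := by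
    intro p u
    induction u generalizing p with
    | nil => rintro q h hp; obtain rfl : p = q := h; exact hp
    | cons e u ih => exact fun h _ => ih h.2.2 (hV e h.1)
  by_cases hSs : SI s
  · obtain ⟨b, hb⟩ := option_of_walk hw
    refine ⟨[] ++ b, mem_candidates.2 ⟨s, hs, [], nil_mem_options, f, hf, b, hb, rfl⟩, ?_⟩
    exact (suffix_indep hSs (nil_mem_options) ⟨f, hf, hb⟩ hf hw).symm
  by_cases hPf : PI f
  · obtain ⟨a, ha⟩ := option_of_walk hw
    refine ⟨a ++ [], mem_candidates.2
      ⟨f, hmem hw hs, a, ha, f, hf, [], nil_mem_options, rfl⟩, ?_⟩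
    rw [← prefix_indep hPf ⟨f, hf, nil_mem_options⟩ ha hw, List.append_nil]
  -- Without `SI` at the start there is `PI` there, and without `PI` at the end there is `SI` there.
  -- The first edge that enters an `SI` state leaves a `PI` state.
  have split : ∀ {p u}, IsWalk E p u f → p ∈ V → ¬ SI p →
      ∃ u₁ e u₂, u = u₁ ++ e :: u₂ ∧ PI e.1 ∧ SI e.2.2 := by
    intro p u
    induction u generalizing p with
    | nil =>
      intro h hp hSp
      obtain rfl : p = f := h
      exact absurd ((hPS p hp).resolve_right hSp) hPf
    | cons e u ih =>
      intro h hp hSp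
      by_cases hSe : SI e.2.2
      · refine ⟨[], e, u, rfl, ?_, hSe⟩
        rw [h.2.1]
        exact (hPS p hp).resolve_right hSp
      · obtain ⟨u₁, e', u₂, rfl, h₁, h₂⟩ := ih h.2.2 (hV e h.1) hSe
        exact ⟨e :: u₁, e', u₂, rfl, h₁, h₂⟩
  obtain ⟨u₁, e, u₂, rfl, hP, hS⟩ := split hw hs hSs
  obtain ⟨p, h₁, he, rfl, h₂⟩ := isWalk_append.1 hw
  have hpV : e.1 ∈ V := hmem h₁ hs
  -- The edge `e` is attached once to a suffix `w₀`, giving an option out of its source, and once to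
  -- a prefix `v₀`, giving an option into its target. This links `PI` at the source with `SI` at the
  -- target.
  obtain ⟨w₀, hw₀, -, hc₀⟩ := exists_cons_mem_options hE (z := B) he h₂ (hE e he).ne'
    (notMem_labels_of_le hE h₂ le_rfl)
  obtain ⟨v₀, hv₀, hd₀⟩ := exists_concat_mem_options hE he h₁
  obtain ⟨a, ha⟩ := option_of_walk h₁
  refine ⟨a ++ e.2.1 :: labels w₀, mem_candidates.2 ⟨e.1, hpV, a, ha, f, hf, _, hc₀, rfl⟩, ?_⟩
  have k₁ := prefix_indep hP ⟨f, hf, hc₀⟩ ha h₁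
  have k₂ := prefix_indep hP ⟨f, hf, hc₀⟩ ha hv₀
  obtain ⟨b, hb⟩ := option_of_walk h₂
  have k₃ := suffix_indep hS hd₀ ⟨f, hf, hb⟩ hf h₂
  have k₄ := suffix_indep hS hd₀ ⟨f, hf, hb⟩ hf hw₀
  have e₁ : ∀ x, x ∈ a ++ e.2.1 :: labels w₀ ↔ x ∈ labels u₁ ++ e.2.1 :: labels w₀ := fun x => by
    rw [← List.mem_toFinset, ← k₁, List.mem_toFinset]
  have e₂ : ∀ x, x ∈ a ++ e.2.1 :: labels w₀ ↔ x ∈ labels v₀ ++ e.2.1 :: labels w₀ := fun x => by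
    rw [← List.mem_toFinset, ← k₂, List.mem_toFinset]
  have e₃ : ∀ x, x ∈ labels v₀ ++ [e.2.1] ++ labels u₂ ↔ x ∈ labels v₀ ++ [e.2.1] ++ labels w₀ :=
    fun x => by rw [← List.mem_toFinset, k₃, ← k₄, List.mem_toFinset]
  ext x
  simp only [List.mem_toFinset, labels_append, labels_cons]
  constructor
  · intro hx
    by_contra hxw
    simp only [List.mem_append, List.mem_cons, not_or] at hxw
    -- With a suffix `wx` that avoids `x`: `x` belongs to the union with prefix `v₀` and suffix
    -- `w₀`, by `SI` also to the one with `v₀` and `wx`, and by `PI` to the one with `u₁` and `wx`.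
    -- None of `u₁`, `e`, `wx` carries `x`.
    obtain ⟨wx, hwx, hxx, hcx⟩ := exists_cons_mem_options hE he h₂ hxw.2.1 hxw.2.2
    have k₅ := prefix_indep hP ⟨f, hf, hcx⟩ ha h₁
    have k₆ := prefix_indep hP ⟨f, hf, hcx⟩ ha hv₀
    have k₇ := suffix_indep hS hd₀ ⟨f, hf, hb⟩ hf hwx
    have hx' : x ∈ labels u₁ ++ e.2.1 :: labels wx := by
      rw [← List.mem_toFinset, k₅, ← k₆, List.mem_toFinset]
      have : x ∈ labels v₀ ++ [e.2.1] ++ labels wx := by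
        rw [← List.mem_toFinset, k₇, ← k₄, List.mem_toFinset]
        simpa using (e₂ x).1 hx
      simpa using this
    simp only [List.mem_append, List.mem_cons] at hx'
    tauto
  · intro hx
    rcases List.mem_append.1 hx with hx | hx
    · exact (e₁ x).2 (List.mem_append_left _ hx)
    · rcases List.mem_cons.1 hx with rfl | hx
      · simp
      · have := (e₃ x).1 (List.mem_append_right _ hx)
        exact (e₂ x).2 (by simpa using this)

end Completeness

end RegReal

namespace RegReal

/-! ### Words accepted by an automaton -/

section Reach

variable {T : List (ℕ × Letter × ℕ)}

/-- The automaton with transitions `T` can read the word `w` from the state `p` to the state `q`. -/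
def Reach (T : List (ℕ × Letter × ℕ)) (p : ℕ) (w : List Letter) (q : ℕ) : Prop :=
  ∃ u, IsWalk T p u q ∧ labels u = w

@[simp] theorem reach_nil {p q : ℕ} : Reach T p [] q ↔ p = q := by
  constructor
  · rintro ⟨u, hu, h⟩
    obtain rfl : u = [] := by simpa [labels] using h
    exact hu
  · exact fun h => ⟨[], h, rfl⟩

theorem reach_cons {p q : ℕ} {c : Letter} {w : List Letter} :
    Reach T p (c :: w) q ↔ ∃ r, (p, c, r) ∈ T ∧ Reach T r w q := by
  constructor
  · rintro ⟨_ | ⟨⟨a, b, r⟩, u⟩, hu, h⟩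
    · simp at h
    · obtain ⟨rfl, rfl⟩ : b = c ∧ labels u = w := by simpa using h
      obtain ⟨hm, rfl, hu⟩ := hu
      exact ⟨r, hm, u, hu, rfl⟩
  · rintro ⟨r, hr, u, hu, rfl⟩
    exact ⟨(p, c, r) :: u, ⟨hr, rfl, hu⟩, rfl⟩

theorem reach_append {p q : ℕ} {w w' : List Letter} :
    Reach T p (w ++ w') q ↔ ∃ r, Reach T p w r ∧ Reach T r w' q := by
  induction w generalizing p with
  | nil => simp
  | cons c w ih =>
    simp only [List.cons_append, reach_cons, ih]
    constructor
    · rintro ⟨r, h, r', h₁, h₂⟩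
      exact ⟨r', ⟨r, h, h₁⟩, h₂⟩
    · rintro ⟨r', ⟨r, h, h₁⟩, h₂⟩
      exact ⟨r, h, r', h₁, h₂⟩

theorem mem_accepts_iff {A : Automaton} {w : List Letter} :
    w ∈ A.toNFA.accepts ↔ ∃ f ∈ A.accept, Reach A.trans A.start w f := by
  have key : ∀ (w : List Letter) (S : Set ℕ) (q : ℕ),
      q ∈ A.toNFA.evalFrom S w ↔ ∃ p ∈ S, Reach A.trans p w q := by
    intro w
    induction w with
    | nil => simp [NFA.evalFrom]
    | cons c w ih =>
      intro S q
      rw [NFA.evalFrom_cons, ih]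
      simp only [NFA.mem_stepSet, reach_cons]
      constructor
      · rintro ⟨r, ⟨p, hp, hr⟩, h⟩
        exact ⟨p, hp, r, hr, h⟩
      · rintro ⟨p, hp, r, hr, h⟩
        exact ⟨r, ⟨p, hp, hr⟩, h⟩
  rw [NFA.mem_accepts]
  simp only [key]
  simp [Automaton.toNFA]

/-- The states that can be reached from the states in `S` by reading the letter `c`. -/
def post (T : List (ℕ × Letter × ℕ)) (S : List ℕ) (c : Letter) : List ℕ :=
  (T.filter fun t => decide (t.2.1 = c) && decide (t.1 ∈ S)).map fun t => t.2.2

theorem mem_post {S : List ℕ} {c : Letter} {q : ℕ} : q ∈ post T S c ↔ ∃ p ∈ S, (p, c, q) ∈ T := by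
  simp only [post, List.mem_map, List.mem_filter, Bool.and_eq_true, decide_eq_true_eq]
  constructor
  · rintro ⟨⟨p, _, _⟩, ⟨h, rfl, hp⟩, rfl⟩
    exact ⟨p, hp, h⟩
  · rintro ⟨p, hp, h⟩
    exact ⟨_, ⟨h, rfl, hp⟩, rfl⟩

theorem mem_foldl_post {w : List Letter} {S : List ℕ} {q : ℕ} :
    q ∈ w.foldl (post T) S ↔ ∃ p ∈ S, Reach T p w q := by
  induction w generalizing S with
  | nil => simp
  | cons c w ih =>
    simp only [List.foldl_cons, ih, mem_post, reach_cons]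
    constructor
    · rintro ⟨r, ⟨p, hp, hr⟩, h⟩
      exact ⟨p, hp, r, hr, h⟩
    · rintro ⟨p, hp, r, hr, h⟩
      exact ⟨r, ⟨p, hp, hr⟩, h⟩

/-! ### Pumping blocks -/

theorem reach_block {p q x : ℕ} : Reach T p (block x) q ↔
    ∃ r s, (p, Letter.lt, r) ∈ T ∧ Reach T r (List.replicate x Letter.a) s ∧
      (s, Letter.rt, q) ∈ T := by
  simp [block, reach_cons, reach_append]

theorem Reach.pump_replicate {p q y : ℕ} {c : Letter} (h : Reach T p (List.replicate y c) q)
    (hy : T.length < y) : ∃ d, 1 ≤ d ∧ d ≤ T.length ∧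
      Reach T p (List.replicate (y - d) c) q ∧ Reach T p (List.replicate (y + d) c) q := by
  obtain ⟨u, hu, hl⟩ := h
  have hlen : u.length = y := by simpa [labels] using congrArg List.length hl
  obtain ⟨w₁, d, w₂, r, rfl, hd, hd', h₁, h₂, h₃⟩ := hu.exists_cycle (by omega)
  rw [labels_append, labels_append, List.eq_replicate_iff] at hl
  simp only [List.length_append] at hlen
  have hmem := hl.2
  simp only [List.mem_append] at hmem
  refine ⟨d.length, hd, hd', ⟨w₁ ++ w₂, isWalk_append.2 ⟨r, h₁, h₃⟩, ?_⟩,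
    ⟨w₁ ++ (d ++ (d ++ w₂)), isWalk_append.2 ⟨r, h₁, isWalk_append.2 ⟨r, h₂, isWalk_append.2
      ⟨r, h₂, h₃⟩⟩⟩, ?_⟩⟩
  · refine List.eq_replicate_iff.2 ⟨by simp [labels]; omega, fun b hb => hmem b ?_⟩
    simp only [labels_append, List.mem_append] at hb
    tauto
  · refine List.eq_replicate_iff.2 ⟨by simp [labels]; omega, fun b hb => hmem b ?_⟩
    simp only [labels_append, List.mem_append] at hb
    tauto

theorem Reach.pump_block {p q y : ℕ} (h : Reach T p (block y) q) (hy : T.length < y) :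
    ∃ d, 1 ≤ d ∧ d ≤ T.length ∧ Reach T p (block (y - d)) q ∧ Reach T p (block (y + d)) q := by
  obtain ⟨r, s, h₁, h₂, h₃⟩ := reach_block.1 h
  obtain ⟨d, hd, hd', h₄, h₅⟩ := h₂.pump_replicate hy
  exact ⟨d, hd, hd', reach_block.2 ⟨r, s, h₁, h₄, h₃⟩, reach_block.2 ⟨r, s, h₁, h₅, h₃⟩⟩

theorem Reach.exists_block_le {p q y : ℕ} (h : Reach T p (block y) q) :
    ∃ y' ≤ T.length, Reach T p (block y') q := by
  induction y using Nat.strong_induction_on with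
  | _ y ih =>
    by_cases hy : y ≤ T.length
    · exact ⟨y, hy, h⟩
    · obtain ⟨d, hd, hd', h₁, -⟩ := h.pump_block (by omega)
      exact ih (y - d) (by omega) h₁

/-- Pumping changes the length by at most `T.length` in either direction, so it cannot jump over an
interval of that many integers. Since the interval lies above `T.length`, pumping stays possible
until it is reached. -/
theorem Reach.exists_block_mem_Ioc {p q y m : ℕ} (h : Reach T p (block y) q) (hy : T.length < y)
    (hm : T.length ≤ m) : ∃ y', m < y' ∧ y' ≤ m + T.length ∧ Reach T p (block y') q := by
  induction hk : (m + 1 - y) + (y - (m + T.length)) using Nat.strong_induction_on generalizing y with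
  | _ k ih =>
    obtain ⟨d, hd, hd', h₁, h₂⟩ := h.pump_block hy
    rcases le_or_gt y m with hym | hym
    · exact ih _ (by omega) h₂ (by omega) rfl
    · by_cases hy' : y ≤ m + T.length
      · exact ⟨y, hym, hy', h⟩
      · exact ih _ (by omega) h₁ (by omega) rfl

theorem reach_flatMap_cons {p q x : ℕ} {xs : List ℕ} : Reach T p ((x :: xs).flatMap block) q ↔
    ∃ r, Reach T p (block x) r ∧ Reach T r (xs.flatMap block) q := by
  rw [List.flatMap_cons, reach_append]

theorem Reach.exists_flatMap_le {p q : ℕ} {xs : List ℕ} (h : Reach T p (xs.flatMap block) q) :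
    ∃ xs' : List ℕ, (∀ x ∈ xs', x ≤ T.length) ∧ Reach T p (xs'.flatMap block) q := by
  induction xs generalizing p with
  | nil => exact ⟨[], by simp, h⟩
  | cons x xs ih =>
    obtain ⟨r, h₁, h₂⟩ := reach_flatMap_cons.1 h
    obtain ⟨y, hy, h₃⟩ := h₁.exists_block_le
    obtain ⟨ys, hys, h₄⟩ := ih h₂
    exact ⟨y :: ys, by simpa [hy] using hys, reach_flatMap_cons.2 ⟨r, h₃, h₄⟩⟩

/-- An automaton that accepts the encoding of a set from the family accepts the encoding of such a
set with small elements. -/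
theorem Reach.exists_mem_family_le {X : Language Bool} {p q : ℕ} {xs : List ℕ}
    (h : Reach T p (xs.flatMap block) q) (hxs : xs.toFinset ∈ family X) :
    ∃ ys : List ℕ, (∀ y ∈ ys, y < 3 * T.length + 1) ∧ ys.toFinset ∈ family X ∧
      Reach T p (ys.flatMap block) q := by
  by_cases hb : ∀ x ∈ xs, x < 3 * T.length + 1
  · exact ⟨xs, hb, hxs, h⟩
  push Not at hb
  obtain ⟨y, hy, hy'⟩ := hb
  obtain ⟨l₁, l₂, rfl⟩ := List.append_of_mem hy
  rw [List.flatMap_append, reach_append] at h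
  obtain ⟨r, h₁, h₂⟩ := h
  obtain ⟨s, h₂, h₃⟩ := reach_flatMap_cons.1 h₂
  obtain ⟨k₁, hk₁, h₁⟩ := h₁.exists_flatMap_le
  obtain ⟨k₂, hk₂, h₃⟩ := h₃.exists_flatMap_le
  -- Two disjoint windows above `T.length` yield distinct lengths, and `z₁` differs from all the
  -- shortened blocks. The end of the second window explains the bound `3 * T.length`.
  obtain ⟨z₁, hz₁, hz₁', h₄⟩ := h₂.exists_block_mem_Ioc (by omega) le_rfl
  obtain ⟨z₂, hz₂, hz₂', h₅⟩ := h₂.exists_block_mem_Ioc (m := 2 * T.length) (by omega) (by omega)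
  have reach : ∀ z, Reach T r (block z) s → Reach T p ((k₁ ++ z :: k₂).flatMap block) q := by
    intro z hz
    rw [List.flatMap_append, reach_append]
    exact ⟨r, h₁, reach_flatMap_cons.2 ⟨s, hz, h₃⟩⟩
  have bound : ∀ z, z ≤ 3 * T.length → ∀ x ∈ k₁ ++ z :: k₂, x < 3 * T.length + 1 := by
    intro z hz x hx
    simp only [List.mem_append, List.mem_cons] at hx
    rcases hx with hx | rfl | hx
    · have := hk₁ x hx; omega
    · omega
    · have := hk₂ x hx; omega
  have toFinset : ∀ z, (k₁ ++ z :: k₂).toFinset = insert z (k₁ ++ k₂).toFinset := by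
    intro z
    ext x
    simp only [List.mem_toFinset, List.mem_append, List.mem_cons, Finset.mem_insert]
    tauto
  have hz₁S : z₁ ∉ (k₁ ++ k₂).toFinset := by
    simp only [List.mem_toFinset, List.mem_append]
    rintro (hz | hz)
    · have := hk₁ _ hz; omega
    · have := hk₂ _ hz; omega
  by_cases hc : IsCode (k₁ ++ z₁ :: k₂).toFinset
  · refine ⟨k₁ ++ z₂ :: k₂, bound _ (by omega), Or.inr fun hc' => ?_, reach _ h₅⟩
    rw [toFinset] at hc hc'
    have := eq_of_isCode_insert hz₁S hc hc'
    omega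
  · exact ⟨k₁ ++ z₁ :: k₂, bound _ (by omega), Or.inr hc, reach _ h₄⟩

/-! ### The queries -/

/-- The graph of the blocks that can be read between two states. -/
def blockEdges (T : List (ℕ × Letter × ℕ)) (V : List ℕ) (B : ℕ) : List (ℕ × ℕ × ℕ) :=
  V.flatMap fun p => (List.range B).flatMap fun y =>
    ((block y).foldl (post T) [p]).map fun q => (p, y, q)

theorem mem_blockEdges {V : List ℕ} {B : ℕ} {e : ℕ × ℕ × ℕ} :
    e ∈ blockEdges T V B ↔ e.1 ∈ V ∧ e.2.1 < B ∧ Reach T e.1 (block e.2.1) e.2.2 := by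
  obtain ⟨p, y, q⟩ := e
  simp only [blockEdges, List.mem_flatMap, List.mem_range, List.mem_map, mem_foldl_post,
    List.mem_singleton, Prod.mk.injEq]
  constructor
  · rintro ⟨p', hp, y', hy, q', ⟨_, rfl, h⟩, rfl, rfl, rfl⟩
    exact ⟨hp, hy, h⟩
  · rintro ⟨hp, hy, h⟩
    exact ⟨p, hp, y, hy, q, ⟨p, rfl, h⟩, rfl, rfl, rfl⟩

theorem Reach.of_isWalk_blockEdges {V : List ℕ} {B p q : ℕ} {w : List (ℕ × ℕ × ℕ)}
    (h : IsWalk (blockEdges T V B) p w q) : Reach T p ((labels w).flatMap block) q := by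
  induction w generalizing p with
  | nil => exact reach_nil.2 h
  | cons e w ih =>
    obtain ⟨he, rfl, h⟩ := h
    exact reach_flatMap_cons.2 ⟨_, (mem_blockEdges.1 he).2.2, ih h⟩

theorem Reach.exists_isWalk_blockEdges {V : List ℕ} {B p q : ℕ} {xs : List ℕ}
    (hV : ∀ t ∈ T, t.2.2 ∈ V) (hp : p ∈ V) (hxs : ∀ x ∈ xs, x < B)
    (h : Reach T p (xs.flatMap block) q) : ∃ w, IsWalk (blockEdges T V B) p w q ∧ labels w = xs := by
  induction xs generalizing p with
  | nil => exact ⟨[], reach_nil.1 h, rfl⟩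
  | cons x xs ih =>
    obtain ⟨r, h₁, h₂⟩ := reach_flatMap_cons.1 h
    obtain ⟨_, _, _, _, h₃⟩ := reach_block.1 h₁
    obtain ⟨w, hw, rfl⟩ := ih (hV _ h₃) (fun x hx => hxs x (List.mem_cons_of_mem _ hx)) h₂
    exact ⟨(p, x, r) :: w, ⟨mem_blockEdges.2 ⟨hp, hxs x List.mem_cons_self, h₁⟩, rfl, hw⟩, rfl⟩

end Reach

/-- The states that can be reached in an automaton. -/
def Automaton.states (A : Automaton) : List ℕ := A.start :: A.trans.map fun t => t.2.2

/-- A list of sets whose encodings are accepted by an automaton. -/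
def Automaton.samples (A : Automaton) : List (List ℕ) :=
  candidates (blockEdges A.trans A.states (3 * A.trans.length + 1)) (3 * A.trans.length + 1)
    A.states A.start A.accept

/-- Samples are realized by the automaton, so one in the family is a witness. Conversely, a sample
that is not a code is in the family at once; otherwise completeness of the candidates applies to a
witness with short blocks. -/
theorem Automaton.exists_sample_iff (A : Automaton) (X : Language Bool) :
    (∃ l ∈ A.samples, l.toFinset ∈ family X) ↔
      ∃ u ∈ encodings (family X), u ∈ A.toNFA.accepts := by
  have hV : ∀ t ∈ A.trans, t.2.2 ∈ A.states := fun t ht =>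
    List.mem_cons_of_mem _ (List.mem_map_of_mem ht)
  constructor
  · rintro ⟨l, hl, hX⟩
    obtain ⟨f, hf, w, hw, rfl⟩ := exists_walk_of_mem_candidates hl
    exact ⟨(labels w).flatMap block, ⟨_, hX, _, rfl, rfl⟩,
      mem_accepts_iff.2 ⟨f, hf, .of_isWalk_blockEdges hw⟩⟩
  · rintro ⟨_, ⟨_, hX, xs, rfl, rfl⟩, hu⟩
    obtain ⟨f, hf, h⟩ := mem_accepts_iff.1 hu
    by_cases hcode : ∀ l ∈ A.samples, IsCode l.toFinset
    · obtain ⟨ys, hys, hX', h'⟩ := h.exists_mem_family_le hX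
      obtain ⟨w, hw, rfl⟩ := h'.exists_isWalk_blockEdges hV List.mem_cons_self hys
      obtain ⟨l, hl, hlw⟩ := exists_candidate (fun e he => (mem_blockEdges.1 he).2.1)
        List.mem_cons_self (fun e he => by
          obtain ⟨_, _, _, _, h₃⟩ := reach_block.1 (mem_blockEdges.1 he).2.2
          exact hV _ h₃) hcode hf hw
      exact ⟨l, hl, hlw ▸ hX'⟩
    · push Not at hcode
      obtain ⟨l, hl, hlc⟩ := hcode
      exact ⟨l, hl, Or.inr hlc⟩

/-! ### Automata that accept a single word -/

/-- The automaton that accepts only the word `w`. -/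
def chain (w : List Letter) : Automaton where
  start := 0
  accept := [w.length]
  trans := w.foldl (fun T c => T ++ [(T.length, c, T.length + 1)]) []

theorem length_chain_trans (w : List Letter) : (chain w).trans.length = w.length := by
  induction w using List.reverseRecOn with
  | nil => rfl
  | append_singleton w c ih => simpa [chain] using ih

theorem chain_trans_append (w : List Letter) (c : Letter) :
    (chain (w ++ [c])).trans = (chain w).trans ++ [(w.length, c, w.length + 1)] := by
  have := length_chain_trans w
  simp only [chain] at this
  simp [chain, this]

theorem mem_chain_trans {w : List Letter} {t : ℕ × Letter × ℕ} :
    t ∈ (chain w).trans ↔ w[t.1]? = some t.2.1 ∧ t.2.2 = t.1 + 1 := by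
  induction w using List.reverseRecOn with
  | nil => simp [chain]
  | append_singleton w c ih =>
    obtain ⟨p, b, q⟩ := t
    rw [chain_trans_append, List.mem_append, ih, List.mem_singleton]
    simp only [Prod.mk.injEq]
    rcases lt_trichotomy p w.length with h | rfl | h
    · rw [List.getElem?_append_left h]
      constructor
      · rintro (h' | h')
        · exact h'
        · omega
      · exact Or.inl
    · simp
      tauto
    · rw [List.getElem?_eq_none (by omega), List.getElem?_eq_none (by simp; omega)]
      simp
      omega

theorem mem_accepts_chain {w u : List Letter} : u ∈ (chain w).toNFA.accepts ↔ u = w := by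
  have key : ∀ u p, p ≤ w.length → (Reach (chain w).trans p u w.length ↔ u = w.drop p) := by
    intro u
    induction u with
    | nil =>
      intro p hp
      rw [reach_nil, eq_comm (a := []), List.drop_eq_nil_iff]
      omega
    | cons c u ih =>
      intro p hp
      rw [reach_cons]
      simp only [mem_chain_trans]
      constructor
      · rintro ⟨r, ⟨h, rfl⟩, h'⟩
        obtain ⟨hp', rfl⟩ := List.getElem?_eq_some_iff.1 h
        rw [List.drop_eq_getElem_cons hp', (ih _ (by omega)).1 h']
      · intro h
        have hp' : p < w.length := by
          by_contra hp'
          rw [List.drop_eq_nil_of_le (by omega)] at h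
          simp at h
        rw [List.drop_eq_getElem_cons hp', List.cons.injEq] at h
        exact ⟨p + 1, ⟨by simp [hp', h.1], rfl⟩, (ih _ (by omega)).2 h.2⟩
  rw [mem_accepts_iff]
  have := key u 0 (Nat.zero_le _)
  rw [List.drop_zero] at this
  rw [← this]
  simp [chain]

/-- An encoding determines its list, hence its set. So the only word of the chain automaton encodes
no set besides the intended one. -/
theorem flatMap_block_injective {xs ys : List ℕ} (h : xs.flatMap block = ys.flatMap block) :
    xs = ys := by
  have key : ∀ {m n : ℕ} {u v : List Letter},
      List.replicate m Letter.a ++ Letter.rt :: u = List.replicate n Letter.a ++ Letter.rt :: v →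
      m = n ∧ u = v := by
    intro m
    induction m with
    | zero =>
      rintro (_ | n) u v h
      · simpa using h
      · simp [List.replicate_succ] at h
    | succ m ih =>
      rintro (_ | n) u v h
      · simp [List.replicate_succ] at h
      · simp only [List.replicate_succ, List.cons_append, List.cons.injEq, true_and] at h
        obtain ⟨rfl, rfl⟩ := ih h
        exact ⟨rfl, rfl⟩
  induction xs generalizing ys with
  | nil =>
    cases ys with
    | nil => rfl
    | cons y ys => simp [block] at h
  | cons x xs ih =>
    cases ys with
    | nil => simp [block] at h
    | cons y ys =>
      simp only [List.flatMap_cons, block, List.cons_append, List.append_assoc, List.nil_append,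
        List.cons.injEq, true_and] at h
      obtain ⟨rfl, h'⟩ := key h
      rw [ih h']

theorem exists_mem_encodings_accepts_chain {X : Language Bool} {x : List Bool} :
    (∃ u ∈ encodings (family X), u ∈ (chain ((codeList x).flatMap block)).toNFA.accepts) ↔
      x ∈ X := by
  simp only [mem_accepts_chain, exists_eq_right]
  rw [← codeSet_mem_family]
  constructor
  · rintro ⟨S, hS, xs, rfl, h⟩
    rw [← flatMap_block_injective h] at hS
    exact hS
  · exact fun h => ⟨_, h, _, rfl, rfl⟩

/-! ### Reading the description of an automaton -/

/-- The state of the parser: the length of the current state name, the source and the letter of the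
current transition, the transitions of the current section, and the earlier sections. -/
abbrev ParserState :=
  ℕ × (ℕ × Letter) × List (ℕ × Letter × ℕ) × List (ℕ × List (ℕ × Letter × ℕ))

/-- One step of the parser. -/
def parseStep (s : ParserState) : Code → ParserState
  | .tick => (s.1 + 1, s.2)
  | .letter x => (0, (s.1, x), s.2.2)
  | .comma => (0, (0, Letter.a), s.2.2.1 ++ [(s.2.1.1, s.2.1.2, s.1)], s.2.2.2)
  | .semicolon => (0, s.2.1, [], (s.1, s.2.2.1) :: s.2.2.2)

/-- The parser, run on a word. -/
def parseWord (w : List Code) : ParserState := w.foldl parseStep (0, (0, Letter.a), [], [])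

/-- The automaton described by a word. -/
def parse (w : List Code) : Automaton where
  start := (parseWord w).2.2.2.tail.headI.1
  accept := (parseWord w).2.2.2.headI.2.map fun t => t.2.2
  trans := (parseWord w).2.2.1

theorem foldl_parseStep_stateName (q n : ℕ) (s : (ℕ × Letter) × List (ℕ × Letter × ℕ) ×
    List (ℕ × List (ℕ × Letter × ℕ))) :
    (stateName q).foldl parseStep (n, s) = (n + q, s) := by
  induction q generalizing n with
  | zero => rfl
  | succ q ih =>
    rw [stateName, List.replicate_succ, List.foldl_cons, ← stateName, parseStep, ih]
    congr 1
    omega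

/-- Finished sections are stacked with the latest first, so accepting states are found at the head
and the initial state just below. Accepting states are stored as dummy transitions, whose targets
are read off. -/
theorem parse_encode (A : Automaton) : parse A.encode = A := by
  have h₁ : ∀ (F : List ℕ) l r, (F.flatMap fun q => stateName q ++ [Code.comma]).foldl parseStep
      (0, (0, Letter.a), l, r) = (0, (0, Letter.a), l ++ F.map (fun q => (0, Letter.a, q)), r) := by
    intro F
    induction F with
    | nil => simp
    | cons q F ih =>
      intro l r
      simp [List.foldl_append, foldl_parseStep_stateName, parseStep, ih]
  have h₂ : ∀ (T : List (ℕ × Letter × ℕ)) l r, (T.flatMap fun t => stateName t.1 ++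
      [Code.letter t.2.1] ++ stateName t.2.2 ++ [Code.comma]).foldl parseStep
      (0, (0, Letter.a), l, r) = (0, (0, Letter.a), l ++ T, r) := by
    intro T
    induction T with
    | nil => simp
    | cons t T ih =>
      intro l r
      simp only [List.flatMap_cons, List.foldl_append, foldl_parseStep_stateName, List.foldl_cons,
        List.foldl_nil, parseStep, ih]
      simp
  have h : parseWord A.encode = (0, (0, Letter.a), A.trans,
      [(0, A.accept.map fun q => (0, Letter.a, q)), (A.start, [])]) := by
    simp only [parseWord, Automaton.encode, List.foldl_append, foldl_parseStep_stateName,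
      List.foldl_cons, List.foldl_nil, parseStep, h₁, h₂]
    simp
  rw [parse, h]
  obtain ⟨s, F, T⟩ := A
  simp [Function.comp_def]

theorem encode_mem_NRR {F : Language Letter} {A : Automaton} :
    A.encode ∈ NRR F ↔ ∃ u ∈ F, u ∈ A.toNFA.accepts := by
  constructor
  · rintro ⟨B, h, hB⟩
    obtain rfl : A = B := by rw [← parse_encode A, h, parse_encode]
    exact hB
  · exact fun h => ⟨A, rfl, h⟩

/-- The queries: the words represented by the samples, where `d` replaces the sets that represent no
word. There are no queries if the input is not the description of an automaton. -/
def queries (d : List Bool) (w : List Code) : List (List Bool) :=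
  if (parse w).encode = w then (parse w).samples.map (decodeD d) else []

/-- The parser is total, so malformed inputs are detected by encoding the result again. For them the
empty disjunction gives the right answer. -/
theorem mem_NRR_iff_exists_query {X : Language Bool} {d : List Bool} (hd : d ∈ X) (w : List Code) :
    w ∈ NRR (encodings (family X)) ↔ ∃ q ∈ queries d w, q ∈ X := by
  unfold queries
  split_ifs with h
  · conv_lhs => rw [← h]
    rw [encode_mem_NRR, ← Automaton.exists_sample_iff]
    simp [decodeD_mem_iff hd]
  · simp only [List.not_mem_nil, false_and, exists_false, iff_false]
    rintro ⟨A, rfl, -⟩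
    rw [parse_encode] at h
    exact h rfl

end RegReal

namespace RegReal

open Enc

/-! ### The reductions are computable in polynomial time -/

/-- The position of a letter in the alphabet. -/
def Letter.index : Letter → ℕ
  | .a => 0
  | .lt => 1
  | .rt => 2
  | .hash => 3

/-- The position of a symbol in the alphabet of descriptions. -/
def Code.index : Code → ℕ
  | .tick => 0
  | .comma => 1
  | .semicolon => 2
  | .letter x => x.index + 3

instance : Enc Letter := .ofNumbering Letter.index fun x y h => by
  cases x <;> cases y <;> first | rfl | cases h

instance : Enc Code := .ofNumbering Code.index fun x y h => by
  rcases x with _ | _ | _ | _ | _ <;> rcases y with _ | _ | _ | _ | _ <;> first | rfl | cases h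

instance : Enc (Option Bool) := .ofNumbering (fun o => o.elim 0 fun b => bif b then 2 else 1)
  fun x y h => by
    rcases x with _ | _ | _ <;> rcases y with _ | _ | _ <;> first | rfl | cases h

instance : Enc Automaton :=
  ⟨fun A => enc (A.start, A.accept, A.trans), fun A B h => by
    obtain ⟨s, F, T⟩ := A
    obtain ⟨s', F', T'⟩ := B
    simpa using Enc.enc_injective h⟩

instance : Inhabited Letter := ⟨.a⟩

instance : Inhabited Code := ⟨.tick⟩

/-- The list of all symbols of descriptions. -/
def Code.all : List Code :=
  [.tick, .comma, .semicolon, .letter .a, .letter .lt, .letter .rt, .letter .hash]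

theorem Code.getElem?_all (c : Code) : Code.all[c.index]? = some c := by
  rcases c with _ | _ | _ | _ | _ <;> rfl

instance : Finite Code :=
  Finite.of_injective (fun c => (⟨c.index, by rcases c with _ | _ | _ | _ | _ <;> decide⟩ : Fin 7))
    fun x y h => by
      rcases x with _ | _ | _ | _ | _ <;> rcases y with _ | _ | _ | _ | _ <;>
        first | rfl | cases h

theorem size_letter_le (x : Letter) : size x ≤ 7 := by
  have : size x = size x.index := rfl
  rw [this, size_nat]
  cases x <;> decide

namespace PT

variable {α β γ σ : Type} [Enc α] [Enc β] [Enc γ] [Enc σ]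

/-- Functions on finite types are computable in polynomial time. -/
theorem of_list [DecidableEq β] [Inhabited γ] {l : List β} (hl : ∀ b, b ∈ l) (f : β → γ) : PT f := by
  have key : ∀ l : List β, PT fun b => if b ∈ l then f b else default := by
    intro l
    induction l with
    | nil => simpa using PT.const (default : γ)
    | cons c l ih =>
      have h : (fun b => if b ∈ c :: l then f b else default) =
          fun b => if b = c then f c else if b ∈ l then f b else default := by
        funext b
        by_cases hb : b = c
        · simp [hb]
        · simp [hb]
      rw [h]
      exact .ite (.decide_eq .id (.const c)) (.const _) ih
  simpa [hl] using key l

theorem automaton_start {f : α → Automaton} (hf : PT f) : PT fun a => (f a).start :=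
  (PT.recode (PT.id (α := ℕ × List ℕ × List (ℕ × Letter × ℕ))).fst
    (fun A : Automaton => (A.start, A.accept, A.trans)) (fun _ => rfl) fun _ => rfl).comp hf

theorem automaton_accept {f : α → Automaton} (hf : PT f) : PT fun a => (f a).accept :=
  (PT.recode (PT.id (α := ℕ × List ℕ × List (ℕ × Letter × ℕ))).snd.fst
    (fun A : Automaton => (A.start, A.accept, A.trans)) (fun _ => rfl) fun _ => rfl).comp hf

theorem automaton_trans {f : α → Automaton} (hf : PT f) : PT fun a => (f a).trans :=
  (PT.recode (PT.id (α := ℕ × List ℕ × List (ℕ × Letter × ℕ))).snd.snd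
    (fun A : Automaton => (A.start, A.accept, A.trans)) (fun _ => rfl) fun _ => rfl).comp hf

theorem automaton_mk {s : α → ℕ} {F : α → List ℕ} {T : α → List (ℕ × Letter × ℕ)} (hs : PT s)
    (hF : PT F) (hT : PT T) : PT fun a => Automaton.mk (s a) (F a) (T a) :=
  (hs.pair (hF.pair hT)).recode (fun a => a) (fun _ => rfl) fun _ => rfl

/-! #### Codes -/

theorem lits {x : α → List Bool} (hx : PT x) : PT fun a => lits (x a) := by
  have hbound : ∀ (x : List Bool), ∀ n ∈ x.foldl (fun (s : List ℕ) b =>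
      s ++ [3 * s.length + (bif b then 1 else 0)]) [], n ≤ 3 * x.length := by
    intro x
    induction x using List.reverseRecOn with
    | nil => simp
    | append_singleton x b ih =>
      intro n hn
      simp only [List.foldl_append, List.foldl_cons, List.foldl_nil, List.mem_append,
        List.mem_singleton, length_foldl_lits] at hn
      rw [List.length_append, List.length_singleton]
      rcases hn with hn | rfl
      · have := ih n hn
        omega
      · cases b <;> simp
  have h : PT fun x : List Bool => x.foldl (fun (s : List ℕ) b =>
      s ++ [3 * s.length + (bif b then 1 else 0)]) [] := by
    refine PT.foldl (g := fun _ (s : List ℕ) b => s ++ [3 * s.length + (bif b then 1 else 0)])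
      PT.id (.const []) (.append (.fst (.snd .id)) (.cons (.add (.mul (.const 3)
        (.length (.fst (.snd .id)))) (.cond (.snd (.snd .id)) (.const 1) (.const 0))) (.const [])))
      (B := fun x => size x * (6 * size x + 2) + 1)
      ((PolyBdd.size_self.mul (((PolyBdd.const 6).mul .size_self).add (.const 2))).add (.const 1))
      fun x l hl => ?_
    have h₁ : l.length ≤ size x := (length_le_size l).trans (size_le_of_prefix hl)
    refine (size_list_le (n := 6 * size x + 1) fun n hn => ?_).trans ?_
    · have := hbound l n hn
      rw [size_nat]
      omega
    · rw [length_foldl_lits]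
      gcongr
  have h' := h.comp hx
  exact h'.append (.cons (.add (.mul (.const 3) h'.length) (.const 2)) (.const []))

theorem pairing {u v : α → ℕ} (hu : PT u) (hv : PT v) : PT fun a => pairing (u a) (v a) :=
  .add (.mul (.add hu hv) (.add hu hv)) hu

theorem codeList {x : α → List Bool} (hx : PT x) : PT fun a => codeList (x a) :=
  .flatMap hx.lits (.map (.lits (hx.comp (.fst .id))) (.pairing (.snd (.fst .id)) (.snd .id)))

theorem decodeBits {l : α → List ℕ} (hl : PT l) : PT fun a => decodeBits (l a) := by
  have h₀ : PT fun p : α × ℕ => 3 * p.2 := .mul (.const 3) (.snd .id)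
  have h₁ : PT fun p : α × ℕ => 3 * p.2 + 1 := h₀.add (.const 1)
  have hl' : PT fun p : α × ℕ => l p.1 := hl.comp (.fst .id)
  exact .flatMap hl.length.range (.ite (.decide_mem (.pairing h₀ h₀) hl') (.const [false])
    (.ite (.decide_mem (.pairing h₁ h₁) hl') (.const [true]) (.const [])))

theorem decodeD (d : List Bool) {l : α → List ℕ} (hl : PT l) : PT fun a => decodeD d (l a) := by
  have h := hl.decodeBits.codeList
  exact .cond (.and (.all hl (.decide_mem (.snd .id) (h.comp (.fst .id))))
    (.all h (.decide_mem (.snd .id) (hl.comp (.fst .id))))) hl.decodeBits (.const d)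

/-! #### Walks -/

theorem lookupFirst {t : α → List (ℕ × List ℕ)} {p : α → ℕ} (ht : PT t) (hp : PT p) :
    PT fun a => lookupFirst (t a) (p a) := by
  have h : PT fun a => (t a).filter fun r => decide (r.1 = p a) :=
    .filter ht (.decide_eq (.fst (.snd .id)) (hp.comp (.fst .id)))
  exact .cond h.isEmpty (.const []) (.cons h.headI.snd (.const []))

theorem extendTable {E : α → List (ℕ × ℕ × ℕ)} {s : α → ℕ} {t : α → List (ℕ × List ℕ)} (hE : PT E)
    (hs : PT s) (ht : PT t) : PT fun a => extendTable (E a) (s a) (t a) :=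
  .cons (hs.pair (.const [])) (.flatMap hE (.map
    (.lookupFirst (ht.comp (.fst .id)) (.fst (.snd .id)))
    (.pair (.snd (.snd (.snd (.fst .id)))) (.append (.snd .id)
      (.cons (.fst (.snd (.snd (.fst .id)))) (.const []))))))

theorem length_flatMap_le {α β : Type} {f : α → List β} {l : List α}
    (h : ∀ a ∈ l, (f a).length ≤ 1) : (l.flatMap f).length ≤ l.length := by
  induction l with
  | nil => simp
  | cons a l ih =>
    have h₁ := ih fun b hb => h b (List.mem_cons_of_mem _ hb)
    have h₂ := h a List.mem_cons_self
    rw [List.flatMap_cons, List.length_append, List.length_cons]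
    omega

/-- Keeping only the first walk per state prevents exponential growth: each edge contributes at most
one row, and each round adds one label to a stored walk. -/
theorem size_walkTable_le (E : List (ℕ × ℕ × ℕ)) (s n : ℕ) : size (walkTable E s n) ≤
    (size E + 1) * (size s + size E + n * size E + 3) + 1 := by
  have hE : ∀ e ∈ E, size e.2.2 ≤ size E ∧ size e.2.1 + 1 ≤ size E := by
    intro e he
    have := size_le_of_mem he
    simp only [size_prod] at this
    omega
  have key : ∀ r ∈ walkTable E s n, size r.1 ≤ size s + size E ∧ size r.2 ≤ n * size E + 1 := by
    induction n with
    | zero => simp [walkTable]; omega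
    | succ n ih =>
      intro r hr
      rw [walkTable_succ, RegReal.extendTable, List.mem_cons] at hr
      rcases hr with rfl | hr
      · simp
      · simp only [List.mem_flatMap, List.mem_map] at hr
        obtain ⟨e, he, w, hw, rfl⟩ := hr
        have h₁ := (ih _ (mem_of_mem_lookupFirst hw)).2
        have h₂ := hE e he
        have h₃ := size_append w [e.2.1]
        simp only [size_cons, size_nil] at h₃
        rw [Nat.add_mul]
        exact ⟨by simp only; omega, by simp only at h₁ ⊢; omega⟩
  have hlen : (walkTable E s n).length ≤ E.length + 1 := by
    cases n with
    | zero => simp [walkTable]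
    | succ n =>
      rw [walkTable_succ, RegReal.extendTable, List.length_cons]
      gcongr
      exact length_flatMap_le fun e _ => by
        rw [List.length_map]
        exact length_lookupFirst_le _ _
  have hlE := length_le_size E
  refine (size_list_le (n := size s + size E + n * size E + 2) fun r hr => ?_).trans ?_
  · have := key r hr
    rw [size_prod]
    omega
  · gcongr
    omega

theorem walkTable {E : α → List (ℕ × ℕ × ℕ)} {s n : α → ℕ} (hE : PT E) (hs : PT s) (hn : PT n) :
    PT fun a => walkTable (E a) (s a) (n a) := by
  refine PT.foldl (g := fun a t _ => RegReal.extendTable (E a) (s a) t) hn.units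
    (.cons (hs.pair (.const [])) (.const []))
    (.extendTable (hE.comp (.fst .id)) (hs.comp (.fst .id)) (.fst (.snd .id)))
    (((hE.1.add (.const 1)).mul (((hs.1.add hE.1).add (hn.1.mul hE.1)).add (.const 3))).add
      (.const 1)) fun a l hl => ?_
  obtain ⟨k, hk, rfl⟩ : ∃ k ≤ n a, l = List.replicate k () :=
    ⟨l.length, by simpa using hl.length_le, List.eq_replicate_iff.2 ⟨rfl, fun _ _ => rfl⟩⟩
  refine (size_walkTable_le (E a) (s a) k).trans ?_
  have : k ≤ size (n a) := by
    rw [size_nat]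
    omega
  gcongr

theorem route {E : α → List (ℕ × ℕ × ℕ)} {s t : α → ℕ} (hE : PT E) (hs : PT s) (ht : PT t) :
    PT fun a => route (E a) (s a) (t a) :=
  .lookupFirst (.walkTable hE hs hE.length) ht

theorem options {E : α → List (ℕ × ℕ × ℕ)} {B s t : α → ℕ} (hE : PT E) (hB : PT B) (hs : PT s)
    (ht : PT t) : PT fun a => options (E a) (B a) (s a) (t a) := by
  have h : PT fun p : α × ℕ => (E p.1).filter fun e => !decide (e.2.1 = p.2) :=
    .filter (hE.comp (.fst .id)) (.not (.decide_eq (.fst (.snd (.snd .id))) (.snd (.fst .id))))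
  refine .flatMap (.range (hB.add (.const 1))) (.append (.route h (hs.comp (.fst .id))
    (ht.comp (.fst .id))) (.flatMap h (.flatMap (.route (h.comp (.fst .id))
      (hs.comp (.fst (.fst .id))) (.fst (.snd .id))) (.map (.route (h.comp (.fst (.fst .id)))
        (.snd (.snd (.snd (.fst .id)))) (ht.comp (.fst (.fst (.fst .id)))))
        (.append (.snd (.fst .id)) (.cons (.fst (.snd (.snd (.fst (.fst .id))))) (.snd .id)))))))

theorem candidates {E : α → List (ℕ × ℕ × ℕ)} {B s : α → ℕ} {V F : α → List ℕ} (hE : PT E)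
    (hB : PT B) (hV : PT V) (hs : PT s) (hF : PT F) :
    PT fun a => candidates (E a) (B a) (V a) (s a) (F a) :=
  .flatMap hV (.flatMap (.options (hE.comp (.fst .id)) (hB.comp (.fst .id)) (hs.comp (.fst .id))
    (.snd .id)) (.flatMap (hF.comp (.fst (.fst .id))) (.map (.options
      (hE.comp (.fst (.fst (.fst .id)))) (hB.comp (.fst (.fst (.fst .id))))
      (.snd (.fst (.fst .id))) (.snd .id)) (.append (.snd (.fst (.fst .id))) (.snd .id)))))

/-! #### Automata -/

theorem block {x : α → ℕ} (hx : PT x) : PT fun a => block (x a) :=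
  .append (.cons (.const _) (.replicate hx (.const _))) (.const _)

theorem post {T : α → List (ℕ × Letter × ℕ)} {S : α → List ℕ} {c : α → Letter} (hT : PT T)
    (hS : PT S) (hc : PT c) : PT fun a => post (T a) (S a) (c a) :=
  .map (.filter hT (.and (.decide_eq (.fst (.snd (.snd .id))) (hc.comp (.fst .id)))
    (.decide_mem (.fst (.snd .id)) (hS.comp (.fst .id))))) (.snd (.snd (.snd .id)))

/-- Each transition contributes at most one entry, however often its source is listed in `S`. The
bound is independent of `S`, so iteration over a word does not accumulate duplicates. -/
theorem size_post_le (T : List (ℕ × Letter × ℕ)) (S : List ℕ) (c : Letter) :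
    size (RegReal.post T S c) ≤ size T * (size T + 1) + 1 := by
  refine (size_list_le (n := size T) fun q hq => ?_).trans ?_
  · obtain ⟨p, -, h⟩ := mem_post.1 hq
    have := size_le_of_mem h
    simp only [size_prod] at this
    omega
  · gcongr
    rw [RegReal.post, List.length_map]
    exact (List.length_filter_le _ _).trans (length_le_size T)

theorem foldl_post {T : α → List (ℕ × Letter × ℕ)} {S : α → List ℕ} {w : α → List Letter}
    (hT : PT T) (hS : PT S) (hw : PT w) : PT fun a => (w a).foldl (RegReal.post (T a)) (S a) := by
  refine PT.foldl hw hS (.post (hT.comp (.fst .id)) (.fst (.snd .id)) (.snd (.snd .id)))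
    (((hT.1.mul (hT.1.add (.const 1))).add (.const 1)).add hS.1) fun a l _ => ?_
  rcases List.eq_nil_or_concat l with rfl | ⟨l', c, rfl⟩
  · simp
  · rw [List.concat_eq_append, List.foldl_concat]
    exact (size_post_le _ _ _).trans (Nat.le_add_right _ _)

theorem blockEdges {T : α → List (ℕ × Letter × ℕ)} {V : α → List ℕ} {B : α → ℕ} (hT : PT T)
    (hV : PT V) (hB : PT B) : PT fun a => blockEdges (T a) (V a) (B a) :=
  .flatMap hV (.flatMap (.range (hB.comp (.fst .id))) (.map (.foldl_post
    (hT.comp (.fst (.fst .id))) (.cons (.snd (.fst .id)) (.const [])) (.block (.snd .id)))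
    (.pair (.snd (.fst (.fst .id))) (.pair (.snd (.fst .id)) (.snd .id)))))

theorem samples {A : α → Automaton} (hA : PT A) : PT fun a => (A a).samples := by
  have hT := hA.automaton_trans
  have hV : PT fun a => (A a).states := .cons hA.automaton_start (.map hT (.snd (.snd (.snd .id))))
  have hB : PT fun a => 3 * (A a).trans.length + 1 := .add (.mul (.const 3) hT.length) (.const 1)
  exact .candidates (.blockEdges hT hV hB) hB hV hA.automaton_start hA.automaton_accept

theorem chain {w : α → List Letter} (hw : PT w) : PT fun a => chain (w a) := by
  have h : PT fun w : List Letter =>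
      w.foldl (fun (T : List (ℕ × Letter × ℕ)) c => T ++ [(T.length, c, T.length + 1)]) [] := by
    refine PT.foldl (g := fun _ (T : List (ℕ × Letter × ℕ)) c =>
      T ++ [(T.length, c, T.length + 1)]) PT.id (.const []) (.append (.fst (.snd .id)) (.cons
        (.pair (.length (.fst (.snd .id))) (.pair (.snd (.snd .id))
          (.add (.length (.fst (.snd .id))) (.const 1)))) (.const [])))
      (B := fun w => size w * (4 * size w + 13) + 1)
      ((PolyBdd.size_self.mul (((PolyBdd.const 4).mul .size_self).add (.const 13))).add (.const 1))
      fun w l hl => ?_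
    have h₁ : l.length ≤ size w := (length_le_size l).trans (size_le_of_prefix hl)
    change size (RegReal.chain l).trans ≤ _
    refine (size_list_le (n := 4 * size w + 12) fun t ht => ?_).trans ?_
    · obtain ⟨h₂, h₃⟩ := mem_chain_trans.1 ht
      have := (List.getElem?_eq_some_iff.1 h₂).1
      have := size_letter_le t.2.1
      simp only [size_prod, size_nat, h₃]
      omega
    · rw [length_chain_trans]
      gcongr
  exact .automaton_mk (.const 0) (.cons hw.length (.const [])) (h.comp hw)

theorem stateName {q : α → ℕ} (hq : PT q) : PT fun a => stateName (q a) :=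
  .replicate hq (.const _)

theorem code_letter {x : α → Letter} (hx : PT x) : PT fun a => Code.letter (x a) :=
  (PT.of_list (l := [.a, .lt, .rt, .hash]) (by rintro (_ | _ | _ | _) <;> simp) _).comp hx

theorem encode {A : α → Automaton} (hA : PT A) : PT fun a => (A a).encode :=
  .append (.append (.append (.append hA.automaton_start.stateName (.const _))
    (.flatMap hA.automaton_accept (.append (.stateName (.snd .id)) (.const _)))) (.const _))
    (.flatMap hA.automaton_trans (.append (.append (.append (.stateName (.fst (.snd .id)))
      (.cons (.code_letter (.fst (.snd (.snd .id)))) (.const [])))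
      (.stateName (.snd (.snd (.snd .id))))) (.const _)))

/-- The letter in a symbol of a description. -/
def _root_.RegReal.Code.toLetter : Code → Letter
  | .letter x => x
  | _ => .a

theorem parseStep {s : α → ParserState} {c : α → Code} (hs : PT s) (hc : PT c) :
    PT fun a => parseStep (s a) (c a) := by
  have h : (fun a => RegReal.parseStep (s a) (c a)) = fun a =>
      if c a = .tick then ((s a).1 + 1, (s a).2) else
      if c a = .comma then
        (0, (0, Letter.a), (s a).2.2.1 ++ [((s a).2.1.1, (s a).2.1.2, (s a).1)], (s a).2.2.2) else
      if c a = .semicolon then (0, (s a).2.1, [], ((s a).1, (s a).2.2.1) :: (s a).2.2.2) else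
      (0, ((s a).1, (c a).toLetter), (s a).2.2) := by
    funext a
    cases c a <;> rfl
  have hl : PT fun a => (c a).toLetter := (PT.of_list (l := Code.all)
    (fun c => List.mem_of_getElem? c.getElem?_all) _).comp hc
  rw [h]
  exact .ite (.decide_eq hc (.const _)) (.pair (.add hs.fst (.const 1)) hs.snd)
    (.ite (.decide_eq hc (.const _)) (.pair (.const 0) (.pair (.const _) (.pair
      (.append hs.snd.snd.fst (.cons (.pair hs.snd.fst.fst (.pair hs.snd.fst.snd hs.fst))
        (.const []))) hs.snd.snd.snd)))
    (.ite (.decide_eq hc (.const _)) (.pair (.const 0) (.pair hs.snd.fst (.pair (.const [])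
      (.cons (.pair hs.fst hs.snd.snd.fst) hs.snd.snd.snd))))
    (.pair (.const 0) (.pair (.pair hs.fst hl) hs.snd.snd))))

theorem size_parseStep_le (s : ParserState) (c : Code) :
    size (RegReal.parseStep s c) ≤ size s + 20 := by
  cases c with
  | tick => simp [RegReal.parseStep]; omega
  | letter x =>
    have := size_letter_le x
    simp [RegReal.parseStep]
    omega
  | comma =>
    have h₁ := size_letter_le Letter.a
    have h₂ := size_append s.2.2.1 [(s.2.1.1, s.2.1.2, s.1)]
    simp [RegReal.parseStep] at h₂ ⊢
    omega
  | semicolon => simp [RegReal.parseStep]; omega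

theorem parse {w : α → List Code} (hw : PT w) : PT fun a => parse (w a) := by
  have h : PT fun w : List Code => parseWord w := by
    refine PT.foldl (g := fun _ => RegReal.parseStep) PT.id (.const _)
      (.parseStep (.fst (.snd .id)) (.snd (.snd .id)))
      (((PolyBdd.const 20).mul .size_self).add
        (.const (size ((0, (0, Letter.a), [], []) : ParserState)))) fun w l hl => ?_
    have h₁ : l.length ≤ size w := (length_le_size l).trans (size_le_of_prefix hl)
    have h₂ : ∀ (l : List Code) (s : ParserState),
        size (l.foldl RegReal.parseStep s) ≤ 20 * l.length + size s := by
      intro l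
      induction l with
      | nil => simp
      | cons c l ih =>
        intro s
        have := ih (RegReal.parseStep s c)
        have := size_parseStep_le s c
        rw [List.foldl_cons, List.length_cons]
        omega
    refine (h₂ l _).trans ?_
    gcongr
  have h' := h.comp hw
  exact .automaton_mk h'.snd.snd.snd.tail.headI.fst
    (.map h'.snd.snd.snd.headI.snd (.snd (.snd (.snd .id)))) h'.snd.snd.fst

theorem queries (d : List Bool) : PT (queries d) :=
  .ite (.decide_eq PT.id.parse.encode .id) (.map PT.id.parse.samples (.decodeD d (.snd .id)))
    (.const [])

theorem encodeQueries {q : α → List (List Bool)} (hq : PT q) : PT fun a => encodeQueries (q a) :=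
  .flatMap hq (.append (.map (.snd .id) ((PT.of_list (l := [false, true]) (by simp) some).comp
    (.snd .id))) (.const _))

end PT

end RegReal

theorem theorem1 (X : Language Bool) (hX : ∃ x, x ∈ X) :
    ∃ U : Set (Finset ℕ),
      RegReal.ManyOneP X (RegReal.NRR (RegReal.encodings U)) ∧
      RegReal.DttFNP (RegReal.NRR (RegReal.encodings U)) X := by
  open RegReal in
  obtain ⟨d, hd⟩ := hX
  refine ⟨family X, ⟨fun x => (chain ((codeList x).flatMap block)).encode, ?_, fun x => ?_⟩,
    -- The query list is computed in plain polynomial time, so the empty oracle is enough for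
    -- membership in FNP.
    ⟨queries d, ⟨⊥, inNP_bot, ?_⟩, mem_NRR_iff_exists_query hd⟩⟩
  · exact PT.polyTime (.encode (.chain (.flatMap (.codeList .id) (.block (.snd .id)))))
      (l := Code.all) fun c => ⟨c.index, c.getElem?_all, rfl⟩
  · rw [encode_mem_NRR, exists_mem_encodings_accepts_chain]
  · refine PT.polyTimeWithOracle (.encodeQueries (.queries d))
      (l := [none, some false, some true]) ?_ ⊥
    rintro (_ | _ | _)
    exacts [⟨0, rfl, rfl⟩, ⟨1, rfl, rfl⟩, ⟨2, rfl, rfl⟩]
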